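/- Let $\mathbb{F}_3=\{0,1,2\}$ be the field of order $3$, let $\mathrm{wt}$ denote the number of nonzero components of a vector, and write vectors of $\mathbb{F}_3^{12}$ as $c=(x_1,\ldots,x_{10},y_1,y_2)$. A ternary $[12,5]$ code is a $5$-dimensional subspace $C$ of $\mathbb{F}_3^{12}$. Consider the following conditions, required for every codeword $c=(x_1,\ldots,x_{10},y_1,y_2)\in C$: (C1) $\mathrm{wt}((x_1,\ldots,x_{10}))\equiv y_1y_2 \pmod 3$; (C2) if $c$ is not the zero vector, then $\mathrm{wt}((x_1,\ldots,x_{10}))\ge 3$; (C3) if $\mathrm{wt}((x_1,\ldots,x_{10}))=3$, then $(y_1,y_2)\ne(0,0)$. Two such codes are called SZ-equivalent if one is the image of the other under a map $$(x_1,\ldots,x_{10},y_1,y_2)\mapsto((-1)^{\alpha_1}x_{\sigma(1)},\ldots,(-1)^{\alpha_{10}}x_{\sigma(10)},(-1)^{\beta}y_{\tau(1)},(-1)^{\beta}y_{\tau(2)})$$ with $\alpha_1,\ldots,\alpha_{10},\beta\in\{0,1\}$, $\sigma\in S_{10}$ and $\tau\in S_2$. Let $C_1,\ldots,C_7\subseteq\mathbb{F}_3^{12}$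 be the row spaces of the following matrices $G_1,\ldots,G_7$, which represent the seven codes of Shimada and Zhang up to SZ-equivalence (each digit is one entry; the blocks have $5$, $5$ and $2$ columns): $$G_1=\left(\begin{array}{c|c|c} 10000&12210&12\\ 01000&01221&12\\ 00100&10122&12\\ 00010&21012&12\\ 00001&22101&12 \end{array}\right)$$ $$G_2=\left(\begin{array}{c|c|c} 10000&00111&11\\ 01000&01011&22\\ 00100&10101&22\\ 00010&11001&11\\ 00001&12210&12 \end{array}\right)$$ $$G_3=\left(\begin{array}{c|c|c} 10000&00111&11\\ 01000&01011&22\\ 00100&10101&22\\ 00010&11001&11\\ 00001&11111&00 \end{array}\right)$$ $$G_4=\left(\begin{array}{c|c|c} 10000&00011&01\\ 01000&01100&01\\ 00100&10101&22\\ 00010&11010&22\\ 00001&11221&01 \end{array}\right)$$ $$G_5=\left(\begin{array}{c|c|c} 10000&00011&01\\ 01000&01100&01\\ 00100&10101&22\\ 00010&11010&22\\ 00001&12222&20 \end{array}\right)$$ $$G_6=\left(\begin{array}{c|c|c} 10000&00011&01\\ 01000&00101&20\\ 00100&01010&20\\ 00010&01100&01\\ 00001&11221&00 \end{array}\right)$$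 $$G_7=\left(\begin{array}{c|c|c} 10000&00011&01\\ 01000&00101&20\\ 00100&01010&20\\ 00010&01100&01\\ 00001&01111&12 \end{array}\right)$$ Theorem. The codes $C_1,\ldots,C_7$ are ternary $[12,5]$ codes satisfying (C1)–(C3), no two of them are SZ-equivalent, and every ternary $[12,5]$ code satisfying (C1)–(C3) is SZ-equivalent to one of them. -/

import Mathlib

/-- The first ten coordinates `(x₁, …, x₁₀)` of a vector `(x₁, …, x₁₀, y₁, y₂)` of `𝔽₃¹²`. -/
def xPart (c : Fin 12 → ZMod 3) : Fin 10 → ZMod 3 := fun i => c (Fin.castAdd 2 i)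

/-- The last two coordinates `(y₁, y₂)` of a vector `(x₁, …, x₁₀, y₁, y₂)` of `𝔽₃¹²`. -/
def yPart (c : Fin 12 → ZMod 3) : Fin 2 → ZMod 3 := fun j => c (Fin.natAdd 10 j)

/-- The number of nonzero components among the first ten coordinates. -/
def xWeight (c : Fin 12 → ZMod 3) : ℕ := hammingNorm (xPart c)

/-- A ternary `[12, 5]` code satisfying the three conditions: for every codeword
`c = (x₁, …, x₁₀, y₁, y₂)`, (C1) `wt (x₁, …, x₁₀) ≡ y₁ y₂ (mod 3)`;
(C2) if `c ≠ 0` then `wt (x₁, …, x₁₀) ≥ 3`;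
(C3) if `wt (x₁, …, x₁₀) = 3` then `(y₁, y₂) ≠ (0, 0)`. -/
structure IsSZCode (C : Submodule (ZMod 3) (Fin 12 → ZMod 3)) : Prop where
  dim : Module.finrank (ZMod 3) C = 5
  c1 : ∀ c ∈ C, (xWeight c : ZMod 3) = yPart c 0 * yPart c 1
  c2 : ∀ c ∈ C, c ≠ 0 → 3 ≤ xWeight c
  c3 : ∀ c ∈ C, xWeight c = 3 → (yPart c 0, yPart c 1) ≠ (0, 0)

/-- The map `(x₁, …, x₁₀, y₁, y₂) ↦
((-1)^α₁ x_σ(1), …, (-1)^α₁₀ x_σ(10), (-1)^β y_τ(1), (-1)^β y_τ(2))`. -/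
def szMap (α : Fin 10 → Fin 2) (β : Fin 2) (σ : Equiv.Perm (Fin 10)) (τ : Equiv.Perm (Fin 2))
    (c : Fin 12 → ZMod 3) : Fin 12 → ZMod 3 :=
  Fin.append (m := 10) (n := 2)
    (fun i => (-1) ^ (α i : ℕ) * xPart c (σ i))
    (fun j => (-1) ^ (β : ℕ) * yPart c (τ j))

/-- SZ-equivalence: `C'` is the image of `C` under one of the maps `szMap α β σ τ`
(these maps form a group). -/
def SZEquiv (C C' : Submodule (ZMod 3) (Fin 12 → ZMod 3)) : Prop :=
  ∃ (α : Fin 10 → Fin 2) (β : Fin 2) (σ : Equiv.Perm (Fin 10)) (τ : Equiv.Perm (Fin 2)),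
    szMap α β σ τ '' (C : Set (Fin 12 → ZMod 3)) = (C' : Set (Fin 12 → ZMod 3))

/-- Generator matrices `(I₅ | A | aᵀ bᵀ)` of the seven codes. -/
def szGen : Fin 7 → Matrix (Fin 5) (Fin 12) (ZMod 3) :=
  ![
    !![1, 0, 0, 0, 0, 1, 2, 2, 1, 0, 1, 2;
       0, 1, 0, 0, 0, 0, 1, 2, 2, 1, 1, 2;
       0, 0, 1, 0, 0, 1, 0, 1, 2, 2, 1, 2;
       0, 0, 0, 1, 0, 2, 1, 0, 1, 2, 1, 2;
       0, 0, 0, 0, 1, 2, 2, 1, 0, 1, 1, 2],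
    !![1, 0, 0, 0, 0, 0, 0, 1, 1, 1, 1, 1;
       0, 1, 0, 0, 0, 0, 1, 0, 1, 1, 2, 2;
       0, 0, 1, 0, 0, 1, 0, 1, 0, 1, 2, 2;
       0, 0, 0, 1, 0, 1, 1, 0, 0, 1, 1, 1;
       0, 0, 0, 0, 1, 1, 2, 2, 1, 0, 1, 2],
    !![1, 0, 0, 0, 0, 0, 0, 1, 1, 1, 1, 1;
       0, 1, 0, 0, 0, 0, 1, 0, 1, 1, 2, 2;
       0, 0, 1, 0, 0, 1, 0, 1, 0, 1, 2, 2;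
       0, 0, 0, 1, 0, 1, 1, 0, 0, 1, 1, 1;
       0, 0, 0, 0, 1, 1, 1, 1, 1, 1, 0, 0],
    !![1, 0, 0, 0, 0, 0, 0, 0, 1, 1, 0, 1;
       0, 1, 0, 0, 0, 0, 1, 1, 0, 0, 0, 1;
       0, 0, 1, 0, 0, 1, 0, 1, 0, 1, 2, 2;
       0, 0, 0, 1, 0, 1, 1, 0, 1, 0, 2, 2;
       0, 0, 0, 0, 1, 1, 1, 2, 2, 1, 0, 1],
    !![1, 0, 0, 0, 0, 0, 0, 0, 1, 1, 0, 1;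
       0, 1, 0, 0, 0, 0, 1, 1, 0, 0, 0, 1;
       0, 0, 1, 0, 0, 1, 0, 1, 0, 1, 2, 2;
       0, 0, 0, 1, 0, 1, 1, 0, 1, 0, 2, 2;
       0, 0, 0, 0, 1, 1, 2, 2, 2, 2, 2, 0],
    !![1, 0, 0, 0, 0, 0, 0, 0, 1, 1, 0, 1;
       0, 1, 0, 0, 0, 0, 0, 1, 0, 1, 2, 0;
       0, 0, 1, 0, 0, 0, 1, 0, 1, 0, 2, 0;
       0, 0, 0, 1, 0, 0, 1, 1, 0, 0, 0, 1;
       0, 0, 0, 0, 1, 1, 1, 2, 2, 1, 0, 0],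
    !![1, 0, 0, 0, 0, 0, 0, 0, 1, 1, 0, 1;
       0, 1, 0, 0, 0, 0, 0, 1, 0, 1, 2, 0;
       0, 0, 1, 0, 0, 0, 1, 0, 1, 0, 2, 0;
       0, 0, 0, 1, 0, 0, 1, 1, 0, 0, 0, 1;
       0, 0, 0, 0, 1, 0, 1, 1, 1, 1, 1, 2]]

/-- The seven codes: the row spaces of the seven generator matrices. -/
def szCode (i : Fin 7) : Submodule (ZMod 3) (Fin 12 → ZMod 3) :=
  Submodule.span (ZMod 3) (Set.range (szGen i).row)

/-- The y-part `(s, t)` and the last five x-coordinates of a row of a generator matrix. -/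
structure Row where
  s : ℕ
  t : ℕ
  a : ℕ
  b : ℕ
  c : ℕ
  d : ℕ
  e : ℕ

namespace Row

/-- `1` if `n` is nonzero modulo 3, and `0` otherwise. -/
def nz (n : ℕ) : ℕ := Nat.mod (Nat.mul n n) 3

/-- The Hamming weight modulo 3 of the x-coordinates. -/
def weight (r : Row) : ℕ :=
  Nat.add (nz r.a) (Nat.add (nz r.b) (Nat.add (nz r.c) (Nat.add (nz r.d) (nz r.e))))

/-- The linear combination `r + k * x`. -/
def comb (k : ℕ) (r x : Row) : Row :=
  ⟨Nat.add r.s (Nat.mul k x.s), Nat.add r.t (Nat.mul k x.t), Nat.add r.a (Nat.mul k x.a),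
    Nat.add r.b (Nat.mul k x.b), Nat.add r.c (Nat.mul k x.c), Nat.add r.d (Nat.mul k x.d),
    Nat.add r.e (Nat.mul k x.e)⟩

/-- The base 3 number with the digits of the row. -/
def key (r : Row) : ℕ :=
  [r.t, r.a, r.b, r.c, r.d, r.e].foldl (fun n k => Nat.add (Nat.mul 3 n) k) r.s

/-- Condition (C1) for a word with x-weight `w`. -/
def c1 (w : ℕ) (r : Row) : Bool := Nat.beq (Nat.mod w 3) (Nat.mod (Nat.mul r.s r.t) 3)

/-- Conditions (C2) and (C3) for a nonzero word with x-weight `w`. -/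
def c23 (w : ℕ) (r : Row) : Bool :=
  Nat.blt 3 w || (Nat.beq w 3 && !(Nat.beq (nz r.s) 0 && Nat.beq (nz r.t) 0))

/-- The polar form of the quadratic form defining (C1). -/
def form (r x : Row) : ℕ :=
  Nat.add (Nat.mul r.a x.a) (Nat.add (Nat.mul r.b x.b) (Nat.add (Nat.mul r.c x.c)
    (Nat.add (Nat.mul r.d x.d) (Nat.add (Nat.mul r.e x.e)
      (Nat.add (Nat.mul r.s x.t) (Nat.mul r.t x.s))))))

/-- The first nonzero entry of the list is not `2`. -/
def leadOK : List ℕ → Bool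
  | [] => true
  | a :: l => !Nat.beq a 2 && (Nat.beq a 1 || leadOK l)

/-- The row satisfies (C1) to (C3) and is normalized. -/
def single (r : Row) : Bool :=
  (c1 (Nat.succ r.weight) r && c23 (Nat.succ r.weight) r) &&
    leadOK [r.s, r.t, r.a, r.b, r.c, r.d, r.e]

/-- The row `x` can follow the row `r` in a generator matrix with sorted rows. -/
def compat (r x : Row) : Bool :=
  Nat.beq (Nat.mod (form r x) 3) 0 && (Nat.blt r.key x.key &&
    (c23 (Nat.add 2 (comb 1 r x).weight) (comb 1 r x) &&
      c23 (Nat.add 2 (comb 2 r x).weight) (comb 2 r x)))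

/-- The new digit `k` is admissible below a column with digits `p` (in base 3), the previous
column having digits `q` and new digit `j`. -/
def digitOK (p q j k : ℕ) : Bool :=
  !(Nat.beq p 0 && Nat.beq k 2) && !(Nat.beq p q && Nat.blt k j)

/-- The columns remain sorted and normalized if the row `r` is appended to columns with base 3
digits given by `p`. -/
def columnsOK (p r : Row) : Bool :=
  digitOK p.a p.a r.a r.a && (digitOK p.b p.a r.a r.b && (digitOK p.c p.b r.b r.c &&
    (digitOK p.d p.c r.c r.d && digitOK p.e p.d r.d r.e)))

/-- All the rows with digits `0`, `1`, `2`. -/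
def all : List Row :=
  [0, 1].flatMap fun s => [0, 1, 2].flatMap fun t => [0, 1, 2].flatMap fun a =>
    [0, 1, 2].flatMap fun b => [0, 1, 2].flatMap fun c => [0, 1, 2].flatMap fun d =>
      [0, 1, 2].map fun e => ⟨s, t, a, b, c, d, e⟩

/-- Applies `k` to the elements of `l` satisfying `p`, together with those of `acc`. -/
def filterThen (p : Row → Bool) (k : List Row → Bool) : List Row → List Row → Bool
  | [], acc => k acc
  | x :: l, acc => bif p x then filterThen p k l (x :: acc) else filterThen p k l acc

/-- Tests `leaf` on all the extensions of `rows` by `n` rows from `cands`. -/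
def search (leaf : List Row → Bool) : ℕ → List Row → Row → List Row → Bool
  | 0, rows, _, _ => leaf rows
  | n + 1, rows, p, cands => cands.all fun r => !columnsOK p r ||
      filterThen (compat r) (search leaf n (r :: rows) (comb 3 r p)) cands []

end Row

theorem xPart_szMap (α : Fin 10 → Fin 2) (β : Fin 2) (σ : Equiv.Perm (Fin 10))
    (τ : Equiv.Perm (Fin 2)) (c : Fin 12 → ZMod 3) (i : Fin 10) :
    xPart (szMap α β σ τ c) i = (-1) ^ (α i : ℕ) * xPart c (σ i) := by
  simp only [xPart, szMap]
  exact Fin.append_left (m := 10) (n := 2) _ _ i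

theorem yPart_szMap (α : Fin 10 → Fin 2) (β : Fin 2) (σ : Equiv.Perm (Fin 10))
    (τ : Equiv.Perm (Fin 2)) (c : Fin 12 → ZMod 3) (j : Fin 2) :
    yPart (szMap α β σ τ c) j = (-1) ^ (β : ℕ) * yPart c (τ j) := by
  simp only [yPart, szMap]
  exact Fin.append_right (m := 10) (n := 2) _ _ j

theorem ext_xPart_yPart {c d : Fin 12 → ZMod 3} (hx : ∀ i, xPart c i = xPart d i)
    (hy : ∀ j, yPart c j = yPart d j) : c = d := by
  funext k
  refine Fin.addCases (m := 10) (n := 2) (motive := fun k => c k = d k) hx hy k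

theorem neg_one_pow_add_fin (a b : Fin 2) :
    (-1 : ZMod 3) ^ ((a + b : Fin 2) : ℕ) = (-1) ^ (a : ℕ) * (-1) ^ (b : ℕ) := by
  revert a b; decide

theorem szMap_szMap (α α' : Fin 10 → Fin 2) (β β' : Fin 2) (σ σ' : Equiv.Perm (Fin 10))
    (τ τ' : Equiv.Perm (Fin 2)) (c : Fin 12 → ZMod 3) :
    szMap α β σ τ (szMap α' β' σ' τ' c) =
      szMap (fun i => α i + α' (σ i)) (β + β') (σ' * σ) (τ' * τ) c := by
  apply ext_xPart_yPart <;> intro i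
  · simp only [xPart_szMap, neg_one_pow_add_fin, Equiv.Perm.mul_apply, mul_assoc]
  · simp only [yPart_szMap, neg_one_pow_add_fin, Equiv.Perm.mul_apply, mul_assoc]

theorem SZEquiv.trans {C C' C'' : Submodule (ZMod 3) (Fin 12 → ZMod 3)} (h : SZEquiv C C')
    (h' : SZEquiv C' C'') : SZEquiv C C'' := by
  obtain ⟨α, β, σ, τ, h⟩ := h
  obtain ⟨α', β', σ', τ', h'⟩ := h'
  refine ⟨fun i => α' i + α (σ' i), β' + β, σ * σ', τ * τ', ?_⟩
  rw [← h', ← h, Set.image_image]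
  simp only [szMap_szMap]

/-- The map `szMap` as a linear map. -/
def szLinear (α : Fin 10 → Fin 2) (β : Fin 2) (σ : Equiv.Perm (Fin 10)) (τ : Equiv.Perm (Fin 2)) :
    (Fin 12 → ZMod 3) →ₗ[ZMod 3] (Fin 12 → ZMod 3) where
  toFun := szMap α β σ τ
  map_add' c d := by
    apply ext_xPart_yPart <;> intro i
    · rw [xPart_szMap, show xPart (c + d) (σ i) = xPart c (σ i) + xPart d (σ i) from rfl, mul_add]
      exact congrArg₂ (· + ·) (xPart_szMap ..).symm (xPart_szMap ..).symm
    · rw [yPart_szMap, show yPart (c + d) (τ i) = yPart c (τ i) + yPart d (τ i) from rfl, mul_add]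
      exact congrArg₂ (· + ·) (yPart_szMap ..).symm (yPart_szMap ..).symm
  map_smul' r c := by
    apply ext_xPart_yPart <;> intro i
    · rw [xPart_szMap]
      simp only [xPart, Pi.smul_apply, smul_eq_mul, RingHom.id_apply, mul_left_comm _ r]
      exact congrArg (r * ·) (xPart_szMap ..).symm
    · rw [yPart_szMap]
      simp only [yPart, Pi.smul_apply, smul_eq_mul, RingHom.id_apply, mul_left_comm _ r]
      exact congrArg (r * ·) (yPart_szMap ..).symm

theorem szLinear_apply (α : Fin 10 → Fin 2) (β : Fin 2) (σ : Equiv.Perm (Fin 10))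
    (τ : Equiv.Perm (Fin 2)) (c : Fin 12 → ZMod 3) :
    szLinear α β σ τ c = szMap α β σ τ c := rfl

theorem neg_one_pow_mul_eq_zero {n : ℕ} {x : ZMod 3} : (-1) ^ n * x = 0 ↔ x = 0 :=
  (IsUnit.mul_right_eq_zero (IsUnit.pow n (by decide)))

theorem szLinear_injective (α : Fin 10 → Fin 2) (β : Fin 2) (σ : Equiv.Perm (Fin 10))
    (τ : Equiv.Perm (Fin 2)) : Function.Injective (szLinear α β σ τ) := by
  rw [injective_iff_map_eq_zero]
  intro c hc
  rw [szLinear_apply] at hc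
  apply ext_xPart_yPart <;> intro i
  · have := xPart_szMap α β σ τ c (σ.symm i)
    rw [hc, Equiv.apply_symm_apply] at this
    exact neg_one_pow_mul_eq_zero.1 this.symm
  · have := yPart_szMap α β σ τ c (τ.symm i)
    rw [hc, Equiv.apply_symm_apply] at this
    exact neg_one_pow_mul_eq_zero.1 this.symm

theorem finrank_map_szLinear (α : Fin 10 → Fin 2) (β : Fin 2) (σ : Equiv.Perm (Fin 10))
    (τ : Equiv.Perm (Fin 2)) (C : Submodule (ZMod 3) (Fin 12 → ZMod 3)) :
    Module.finrank (ZMod 3) (C.map (szLinear α β σ τ)) = Module.finrank (ZMod 3) C :=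
  (Submodule.equivMapOfInjective _ (szLinear_injective α β σ τ) C).finrank_eq.symm

theorem szEquiv_of_mapsTo {C C' : Submodule (ZMod 3) (Fin 12 → ZMod 3)}
    (hr : Module.finrank (ZMod 3) C = Module.finrank (ZMod 3) C') (α : Fin 10 → Fin 2) (β : Fin 2)
    (σ : Equiv.Perm (Fin 10)) (τ : Equiv.Perm (Fin 2)) (h : ∀ c ∈ C, szMap α β σ τ c ∈ C') :
    SZEquiv C C' := by
  refine ⟨α, β, σ, τ, ?_⟩
  have hle : C.map (szLinear α β σ τ) ≤ C' := by
    rintro _ ⟨c, hc, rfl⟩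
    exact h c hc
  have he := Submodule.eq_of_le_of_finrank_eq hle
    ((finrank_map_szLinear α β σ τ C).trans hr)
  rw [← he]
  rfl

theorem xWeight_szMap (α : Fin 10 → Fin 2) (β : Fin 2) (σ : Equiv.Perm (Fin 10))
    (τ : Equiv.Perm (Fin 2)) (c : Fin 12 → ZMod 3) : xWeight (szMap α β σ τ c) = xWeight c := by
  unfold xWeight hammingNorm
  refine Finset.card_bij (fun i _ => σ i) ?_ (fun _ _ _ _ h => σ.injective h) ?_
  · intro i hi
    simpa [xPart_szMap, neg_one_pow_mul_eq_zero] using hi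
  · intro i hi
    exact ⟨σ.symm i, by simpa [xPart_szMap, neg_one_pow_mul_eq_zero] using hi, by simp⟩

theorem yPart_szMap_mul (α : Fin 10 → Fin 2) (β : Fin 2) (σ : Equiv.Perm (Fin 10))
    (τ : Equiv.Perm (Fin 2)) (c : Fin 12 → ZMod 3) :
    yPart (szMap α β σ τ c) 0 * yPart (szMap α β σ τ c) 1 = yPart c 0 * yPart c 1 := by
  have hs : ((-1 : ZMod 3) ^ (β : ℕ)) * (-1) ^ (β : ℕ) = 1 := by rw [← mul_pow]; simp
  have ht : yPart c (τ 0) * yPart c (τ 1) = yPart c 0 * yPart c 1 := by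
    have h : ∀ τ : Equiv.Perm (Fin 2), τ 0 = 0 ∧ τ 1 = 1 ∨ τ 0 = 1 ∧ τ 1 = 0 := by decide
    rcases h τ with ⟨h0, h1⟩ | ⟨h0, h1⟩ <;> rw [h0, h1]
    exact mul_comm _ _
  rw [yPart_szMap, yPart_szMap, mul_mul_mul_comm, hs, one_mul, ht]

theorem IsSZCode.of_szEquiv {C C' : Submodule (ZMod 3) (Fin 12 → ZMod 3)} (hC : IsSZCode C)
    (h : SZEquiv C C') : IsSZCode C' := by
  obtain ⟨α, β, σ, τ, h⟩ := h
  have hm : C.map (szLinear α β σ τ) = C' := SetLike.coe_injective h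
  have hex : ∀ c ∈ C', ∃ d ∈ C, szMap α β σ τ d = c := by
    intro c hc
    rw [← hm] at hc
    exact hc
  constructor
  · rw [← hm, finrank_map_szLinear α β σ τ C, hC.dim]
  · intro c hc
    obtain ⟨d, hd, rfl⟩ := hex c hc
    rw [xWeight_szMap, yPart_szMap_mul, hC.c1 d hd]
  · intro c hc h0
    obtain ⟨d, hd, rfl⟩ := hex c hc
    rw [xWeight_szMap]
    refine hC.c2 d hd ?_
    rintro rfl
    exact h0 (map_zero (szLinear α β σ τ))
  · intro c hc h3 hy
    obtain ⟨d, hd, rfl⟩ := hex c hc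
    rw [xWeight_szMap] at h3
    refine hC.c3 d hd h3 ?_
    simp only [Prod.mk.injEq, yPart_szMap, neg_one_pow_mul_eq_zero] at hy
    have hall : ∀ j, yPart d j = 0 := fun j => by
      have : ∀ j, yPart d (τ j) = 0 := fun j => by fin_cases j; exacts [hy.1, hy.2]
      simpa using this (τ.symm j)
    rw [hall, hall]

/-- The number of codewords with `4` or `5` nonzero components among the first ten. -/
noncomputable def count (C : Submodule (ZMod 3) (Fin 12 → ZMod 3)) : ℕ :=
  {c | c ∈ C ∧ (xWeight c = 4 ∨ xWeight c = 5)}.ncard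

theorem SZEquiv.count_eq {C C' : Submodule (ZMod 3) (Fin 12 → ZMod 3)} (h : SZEquiv C C') :
    count C = count C' := by
  obtain ⟨α, β, σ, τ, h⟩ := h
  unfold count
  rw [← Set.ncard_image_of_injective _ (szLinear_injective α β σ τ)]
  congr 1
  ext c
  constructor
  · rintro ⟨d, ⟨hd, hw⟩, rfl⟩
    refine ⟨?_, by rwa [szLinear_apply, xWeight_szMap]⟩
    have : szMap α β σ τ d ∈ (C' : Set (Fin 12 → ZMod 3)) := h ▸ ⟨d, hd, rfl⟩
    exact this
  · rintro ⟨hc, hw⟩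
    have : c ∈ (C' : Set (Fin 12 → ZMod 3)) := hc
    rw [← h] at this
    obtain ⟨d, hd, rfl⟩ := this
    rw [xWeight_szMap] at hw
    exact ⟨d, ⟨hd, hw⟩, rfl⟩

namespace Row

/-- The row with all entries zero. -/
def zero : Row := ⟨0, 0, 0, 0, 0, 0, 0⟩

/-- The vector of `𝔽₃¹²` whose first five coordinates are given by `m` and whose other
coordinates are given by `r`. -/
def vec (m : Fin 5 → ℕ) (r : Row) : Fin 12 → ZMod 3 :=
  ![m 0, m 1, m 2, m 3, m 4, r.a, r.b, r.c, r.d, r.e, r.s, r.t]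

/-- The code generated by the matrix `(I₅ | A | aᵀ bᵀ)` whose rows are given by `R`. -/
def code (R : Fin 5 → Row) : Submodule (ZMod 3) (Fin 12 → ZMod 3) :=
  Submodule.span (ZMod 3) (Set.range fun i => vec (Pi.single i 1) (R i))

/-- The linear combination of the rows `R` with coefficients `m₀, …, m₄`. -/
def combo (R : Fin 5 → Row) (m₀ m₁ m₂ m₃ m₄ : ℕ) : Row :=
  comb m₄ (comb m₃ (comb m₂ (comb m₁ (comb m₀ zero (R 0)) (R 1)) (R 2)) (R 3)) (R 4)

/-- The codeword with coefficients `m`. -/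
def word (R : Fin 5 → Row) (m : Fin 5 → ℕ) : Fin 12 → ZMod 3 :=
  vec m (combo R (m 0) (m 1) (m 2) (m 3) (m 4))

theorem vec_comb (k : ℕ) (m m' : Fin 5 → ℕ) (r x : Row) :
    vec (fun i => m i + k * m' i) (comb k r x) = vec m r + (k : ZMod 3) • vec m' x := by
  funext j
  fin_cases j <;> simp [vec, comb]

theorem word_eq_sum (R : Fin 5 → Row) (m : Fin 5 → ℕ) :
    word R m = ∑ i, (m i : ZMod 3) • vec (Pi.single i 1) (R i) := by
  rw [Fin.sum_univ_five]
  funext j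
  fin_cases j <;> simp [word, vec, combo, comb, zero]

theorem exists_nat_eq (m : Fin 5 → ZMod 3) : ∃ n : Fin 5 → ℕ, (∀ i, n i < 3) ∧
    ∀ i, (n i : ZMod 3) = m i :=
  ⟨fun i => (m i).val, fun i => ZMod.val_lt _, fun i => by simp⟩

theorem mem_code {R : Fin 5 → Row} {v : Fin 12 → ZMod 3} :
    v ∈ code R ↔ ∃ m : Fin 5 → ℕ, (∀ i, m i < 3) ∧ word R m = v := by
  rw [code, Submodule.mem_span_range_iff_exists_fun]
  constructor
  · rintro ⟨m, rfl⟩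
    obtain ⟨n, hn, h⟩ := exists_nat_eq m
    exact ⟨n, hn, by simp only [word_eq_sum, h]⟩
  · rintro ⟨m, -, rfl⟩
    exact ⟨fun i => m i, (word_eq_sum R m).symm⟩

theorem word_mem_code (R : Fin 5 → Row) (m : Fin 5 → ℕ) : word R m ∈ code R := by
  rw [code, Submodule.mem_span_range_iff_exists_fun]
  exact ⟨fun i => m i, (word_eq_sum R m).symm⟩

theorem vec_single_mem_code (R : Fin 5 → Row) (i : Fin 5) : vec (Pi.single i 1) (R i) ∈ code R :=
  Submodule.subset_span ⟨i, rfl⟩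

theorem word_castAdd (R : Fin 5 → Row) (m : Fin 5 → ℕ) (i : Fin 5) :
    word R m (Fin.castAdd 7 i) = m i := by
  fin_cases i <;> rfl

theorem eq_of_word_eq {R : Fin 5 → Row} {m n : Fin 5 → ℕ} (hm : ∀ i, m i < 3)
    (hn : ∀ i, n i < 3) (h : word R m = word R n) : m = n := by
  have key : ∀ i, (m i : ZMod 3) = n i := fun i => by
    rw [← word_castAdd R m, h, word_castAdd]
  funext i
  have := congrArg ZMod.val (key i)
  rwa [ZMod.val_natCast_of_lt (hm i), ZMod.val_natCast_of_lt (hn i)] at this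

theorem finrank_code (R : Fin 5 → Row) : Module.finrank (ZMod 3) (code R) = 5 := by
  rw [code, finrank_span_eq_card, Fintype.card_fin]
  rw [Fintype.linearIndependent_iff]
  intro m hm i
  obtain ⟨n, -, h⟩ := exists_nat_eq m
  simp only [← h] at hm
  rw [← word_eq_sum] at hm
  rw [← h, ← word_castAdd R, hm]
  rfl

theorem nz_eq (n : ℕ) : nz n = if (n : ZMod 3) ≠ 0 then 1 else 0 := by
  have h : ∀ k : Fin 3, (k : ℕ) * k % 3 = if (k : ℕ) ≠ 0 then 1 else 0 := by decide
  have h3 := h ⟨n % 3, Nat.mod_lt _ (by norm_num)⟩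
  rw [← Nat.mul_mod] at h3
  rw [nz, Nat.mul_eq, show Nat.mod (n * n) 3 = n * n % 3 from rfl, h3]
  simp only [ne_eq, ZMod.natCast_eq_zero_iff, Nat.dvd_iff_mod_eq_zero]

theorem xWeight_vec (m : Fin 5 → ℕ) (r : Row) : xWeight (vec m r) =
    nz (m 0) + nz (m 1) + nz (m 2) + nz (m 3) + nz (m 4) + r.weight := by
  rw [xWeight, hammingNorm, Finset.card_filter]
  simp only [Fin.sum_univ_castSucc, weight, nz_eq]
  simp [xPart, vec, add_assoc]
  simp only [← ite_not (p := _ = _)]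
  rfl

/-- The sum of `f` over all the words obtained from a word with x-weight `w + weight v` by adding
a linear combination of the given generators. -/
def wordSum (f : ℕ → Row → ℕ) : List Row → ℕ → Row → ℕ
  | [], w, v => f (Nat.add w v.weight) v
  | g :: gs, w, v => Nat.add (wordSum f gs w v)
      (Nat.add (wordSum f gs (Nat.succ w) (comb 1 v g)) (wordSum f gs (Nat.succ w) (comb 2 v g)))

/-- `1` if the word with x-weight `w` and y-part of `r` violates (C1) to (C3), and `0` otherwise. -/
def violation (w : ℕ) (r : Row) : ℕ :=
  bif Nat.beq w 0 || (c1 w r && c23 w r) then 0 else 1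

/-- `1` if `w` is `4` or `5`, and `0` otherwise. -/
def isFourFive (w : ℕ) (_ : Row) : ℕ := bif Nat.beq w 4 || Nat.beq w 5 then 1 else 0

theorem wordSum_cons (f : ℕ → Row → ℕ) (g : Row) (gs : List Row) (w : ℕ) (v : Row) :
    wordSum f (g :: gs) w v = ∑ k : Fin 3, wordSum f gs (w + nz k) (comb k v g) := by
  rw [Fin.sum_univ_three, add_assoc]
  have h : comb 0 v g = v := by cases v; simp [comb]
  simp only [Fin.val_zero, Fin.val_one, Fin.val_two, h]
  rfl

/-- The coefficients of a linear combination of the five rows. -/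
abbrev Coeff := Fin 3 × Fin 3 × Fin 3 × Fin 3 × Fin 3

/-- The coefficients as a function. -/
def Coeff.toFun (p : Coeff) : Fin 5 → ℕ := ![p.1, p.2.1, p.2.2.1, p.2.2.2.1, p.2.2.2.2]

theorem Coeff.toFun_lt (p : Coeff) (i : Fin 5) : p.toFun i < 3 := by
  fin_cases i <;> exact Fin.is_lt _

theorem Coeff.exists_toFun {m : Fin 5 → ℕ} (h : ∀ i, m i < 3) : ∃ p : Coeff, p.toFun = m :=
  ⟨(⟨m 0, h 0⟩, ⟨m 1, h 1⟩, ⟨m 2, h 2⟩, ⟨m 3, h 3⟩, ⟨m 4, h 4⟩), by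
    funext i; fin_cases i <;> rfl⟩

theorem Coeff.toFun_injective : Function.Injective Coeff.toFun := by
  rintro ⟨a, b, c, d, e⟩ ⟨a', b', c', d', e'⟩ h
  have h' := fun i => congrFun h i
  have h0 := h' 0
  have h1 := h' 1
  have h2 := h' 2
  have h3 := h' 3
  have h4 := h' 4
  simp only [Coeff.toFun] at h0 h1 h2 h3 h4
  simp [Fin.ext_iff] at *
  exact ⟨h0, h1, h2, h3, h4⟩

/-- The row of the codeword with the given coefficients. -/
def Coeff.combo (R : Fin 5 → Row) (p : Coeff) : Row :=
  Row.combo R (p.toFun 0) (p.toFun 1) (p.toFun 2) (p.toFun 3) (p.toFun 4)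

theorem wordSum_eq (f : ℕ → Row → ℕ) (R : Fin 5 → Row) :
    wordSum f [R 0, R 1, R 2, R 3, R 4] 0 zero =
      ∑ p : Coeff, f (xWeight (word R p.toFun)) (p.combo R) := by
  simp only [Fintype.sum_prod_type, wordSum_cons, word, xWeight_vec]
  simp only [wordSum, Coeff.combo, Coeff.toFun, combo, zero_add]
  rfl

theorem count_code (R : Fin 5 → Row) :
    count (code R) = wordSum isFourFive [R 0, R 1, R 2, R 3, R 4] 0 zero := by
  have hs : {c | c ∈ code R ∧ (xWeight c = 4 ∨ xWeight c = 5)} =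
      (fun p : Coeff => word R p.toFun) '' (Finset.univ.filter fun p : Coeff =>
        xWeight (word R p.toFun) = 4 ∨ xWeight (word R p.toFun) = 5 : Finset Coeff) := by
    ext c
    simp only [Set.mem_ofPred_eq, Finset.coe_filter, Finset.mem_univ, true_and, Set.mem_image]
    constructor
    · rintro ⟨hc, hw⟩
      obtain ⟨m, hm, rfl⟩ := mem_code.1 hc
      obtain ⟨p, rfl⟩ := Coeff.exists_toFun hm
      exact ⟨p, hw, rfl⟩
    · rintro ⟨p, hw, rfl⟩
      exact ⟨word_mem_code _ _, hw⟩
  rw [count, hs, Set.ncard_image_of_injective, Set.ncard_coe_finset, wordSum_eq,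
    Finset.card_filter]
  · refine Finset.sum_congr rfl fun p _ => ?_
    by_cases h : xWeight (word R p.toFun) = 4 ∨ xWeight (word R p.toFun) = 5 <;>
      simp [isFourFive, Bool.cond_eq_ite, h]
  · intro p q h
    exact Coeff.toFun_injective (eq_of_word_eq p.toFun_lt q.toFun_lt h)

theorem c1_eq_true {w : ℕ} {r : Row} : c1 w r = true ↔ (w : ZMod 3) = r.s * r.t := by
  rw [c1, Nat.beq_eq, ← Nat.cast_mul, ZMod.natCast_eq_natCast_iff]
  rfl

theorem nz_beq_zero {n : ℕ} : Nat.beq (nz n) 0 = true ↔ (n : ZMod 3) = 0 := by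
  rw [Nat.beq_eq, nz_eq]
  by_cases h : (n : ZMod 3) = 0 <;> simp [h]

theorem c23_eq_true {w : ℕ} {r : Row} : c23 w r = true ↔
    3 ≤ w ∧ (w = 3 → ((r.s : ZMod 3), (r.t : ZMod 3)) ≠ (0, 0)) := by
  rw [c23, Bool.or_eq_true, Bool.and_eq_true, Bool.not_eq_true', ← Bool.not_eq_true,
    Bool.and_eq_true, nz_beq_zero, nz_beq_zero, Nat.blt_eq, Nat.beq_eq, ne_eq,
    Prod.mk.injEq]
  constructor
  · rintro (h | ⟨h, h'⟩)
    · exact ⟨h.le, fun h3 => by omega⟩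
    · exact ⟨h.ge, fun _ => h'⟩
  · rintro ⟨h, h'⟩
    rcases h.lt_or_eq with h | h
    · exact Or.inl h
    · exact Or.inr ⟨h.symm, h' h.symm⟩

theorem isSZCode_code {R : Fin 5 → Row}
    (h : wordSum violation [R 0, R 1, R 2, R 3, R 4] 0 zero = 0) : IsSZCode (code R) := by
  have key : ∀ c ∈ code R, xWeight c = 0 ∨ (xWeight c : ZMod 3) = yPart c 0 * yPart c 1 ∧
      3 ≤ xWeight c ∧ (xWeight c = 3 → (yPart c 0, yPart c 1) ≠ (0, 0)) := by
    intro c hc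
    obtain ⟨m, hm, rfl⟩ := mem_code.1 hc
    obtain ⟨p, rfl⟩ := Coeff.exists_toFun hm
    rw [wordSum_eq, Finset.sum_eq_zero_iff] at h
    have hp := h p (Finset.mem_univ _)
    rw [violation, Bool.cond_eq_ite, ite_eq_left_iff] at hp
    have hp' := not_imp_comm.1 hp (by norm_num)
    rw [Bool.or_eq_true, Bool.and_eq_true, c1_eq_true, c23_eq_true, Nat.beq_eq] at hp'
    exact hp'
  have h0 : ∀ c ∈ code R, xWeight c = 0 → c = 0 := by
    intro c hc hw
    obtain ⟨m, hm, rfl⟩ := mem_code.1 hc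
    have hx : ∀ i, xPart (word R m) i = 0 := congrFun (hammingNorm_eq_zero.1 hw)
    have : m = 0 := by
      funext i
      refine Nat.eq_zero_of_dvd_of_lt ((ZMod.natCast_eq_zero_iff _ 3).1 ?_) (hm i)
      rw [← word_castAdd R]
      exact hx (Fin.castAdd 5 i)
    subst this
    rw [word_eq_sum]
    simp
  refine ⟨finrank_code R, fun c hc => ?_, fun c hc hne => ?_, fun c hc h3 => ?_⟩
  · rcases key c hc with h | h
    · rw [h0 c hc h]
      simp [xWeight, xPart, yPart, hammingNorm]
    · exact h.1
  · exact ((key c hc).resolve_left fun h => hne (h0 c hc h)).2.1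
  · exact ((key c hc).resolve_left fun h => by omega).2.2 h3

/-- The rows of the generator matrices of the seven codes. -/
def target : Fin 7 → Fin 5 → Row :=
  ![![⟨1, 2, 1, 2, 2, 1, 0⟩, ⟨1, 2, 0, 1, 2, 2, 1⟩, ⟨1, 2, 1, 0, 1, 2, 2⟩,
      ⟨1, 2, 2, 1, 0, 1, 2⟩, ⟨1, 2, 2, 2, 1, 0, 1⟩],
    ![⟨1, 1, 0, 0, 1, 1, 1⟩, ⟨2, 2, 0, 1, 0, 1, 1⟩, ⟨2, 2, 1, 0, 1, 0, 1⟩,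
      ⟨1, 1, 1, 1, 0, 0, 1⟩, ⟨1, 2, 1, 2, 2, 1, 0⟩],
    ![⟨1, 1, 0, 0, 1, 1, 1⟩, ⟨2, 2, 0, 1, 0, 1, 1⟩, ⟨2, 2, 1, 0, 1, 0, 1⟩,
      ⟨1, 1, 1, 1, 0, 0, 1⟩, ⟨0, 0, 1, 1, 1, 1, 1⟩],
    ![⟨0, 1, 0, 0, 0, 1, 1⟩, ⟨0, 1, 0, 1, 1, 0, 0⟩, ⟨2, 2, 1, 0, 1, 0, 1⟩,
      ⟨2, 2, 1, 1, 0, 1, 0⟩, ⟨0, 1, 1, 1, 2, 2, 1⟩],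
    ![⟨0, 1, 0, 0, 0, 1, 1⟩, ⟨0, 1, 0, 1, 1, 0, 0⟩, ⟨2, 2, 1, 0, 1, 0, 1⟩,
      ⟨2, 2, 1, 1, 0, 1, 0⟩, ⟨2, 0, 1, 2, 2, 2, 2⟩],
    ![⟨0, 1, 0, 0, 0, 1, 1⟩, ⟨2, 0, 0, 0, 1, 0, 1⟩, ⟨2, 0, 0, 1, 0, 1, 0⟩,
      ⟨0, 1, 0, 1, 1, 0, 0⟩, ⟨0, 0, 1, 1, 2, 2, 1⟩],
    ![⟨0, 1, 0, 0, 0, 1, 1⟩, ⟨2, 0, 0, 0, 1, 0, 1⟩, ⟨2, 0, 0, 1, 0, 1, 0⟩,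
      ⟨0, 1, 0, 1, 1, 0, 0⟩, ⟨1, 2, 0, 1, 1, 1, 1⟩]]

theorem szCode_eq_code (i : Fin 7) : szCode i = code (target i) := by
  have h : ∀ i k, (szGen i).row k = vec (Pi.single k 1) (target i k) := by decide +kernel
  rw [szCode, code]
  congr 2
  exact funext (h i)

theorem isSZCode_szCode (i : Fin 7) : IsSZCode (szCode i) := by
  rw [szCode_eq_code]
  apply isSZCode_code
  revert i
  decide +kernel

theorem eq_of_szEquiv_szCode {i j : Fin 7} (h : SZEquiv (szCode i) (szCode j)) : i = j := by
  have hc := h.count_eq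
  rw [szCode_eq_code, szCode_eq_code, count_code, count_code] at hc
  have hv : ∀ i, wordSum isFourFive [target i 0, target i 1, target i 2, target i 3, target i 4]
      0 zero = ![72, 36, 30, 32, 24, 34, 54] i := by decide +kernel
  rw [hv, hv] at hc
  clear h hv
  revert i j
  decide

/-- The digits of the row are `0`, `1` or `2`. -/
def Reduced (r : Row) : Prop :=
  r.s < 3 ∧ r.t < 3 ∧ r.a < 3 ∧ r.b < 3 ∧ r.c < 3 ∧ r.d < 3 ∧ r.e < 3

theorem szEquiv_code {C : Submodule (ZMod 3) (Fin 12 → ZMod 3)} {R : Fin 5 → Row}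
    (hC : Module.finrank (ZMod 3) C = 5) (α : Fin 10 → Fin 2) (β : Fin 2)
    (σ : Equiv.Perm (Fin 10)) (τ : Equiv.Perm (Fin 2))
    (h : ∀ i, vec (Pi.single i 1) (R i) ∈ C.map (szLinear α β σ τ)) : SZEquiv C (code R) := by
  have hle : code R ≤ C.map (szLinear α β σ τ) := by
    rw [code, Submodule.span_le]
    rintro _ ⟨i, rfl⟩
    exact h i
  have he := Submodule.eq_of_le_of_finrank_eq hle
    (by rw [finrank_map_szLinear, hC, finrank_code])
  refine szEquiv_of_mapsTo (by rw [hC, finrank_code]) α β σ τ fun c hc => ?_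
  rw [he]
  exact ⟨c, hc, rfl⟩

theorem code_szEquiv {R : Fin 5 → Row} {C : Submodule (ZMod 3) (Fin 12 → ZMod 3)}
    (hC : Module.finrank (ZMod 3) C = 5) (α : Fin 10 → Fin 2) (β : Fin 2)
    (σ : Equiv.Perm (Fin 10)) (τ : Equiv.Perm (Fin 2))
    (h : ∀ i, szMap α β σ τ (vec (Pi.single i 1) (R i)) ∈ C) : SZEquiv (code R) C := by
  refine szEquiv_of_mapsTo (by rw [hC, finrank_code]) α β σ τ fun c hc => ?_
  have hle : code R ≤ C.comap (szLinear α β σ τ) := by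
    rw [code, Submodule.span_le]
    rintro _ ⟨i, rfl⟩
    exact h i
  exact hle hc

theorem exists_perm_extending (s : Fin 5 → Fin 10) (hs : Function.Injective s) :
    ∃ σ : Equiv.Perm (Fin 10), ∀ k, σ (Fin.castAdd 5 k) = s k := by
  let e := (Equiv.ofInjective _ (Fin.castAdd_injective 5 5)).symm.trans (Equiv.ofInjective s hs)
  refine ⟨e.extendSubtype, fun k => ?_⟩
  rw [Equiv.extendSubtype_apply_of_mem e _ ⟨k, rfl⟩]
  have : (⟨Fin.castAdd 5 k, ⟨k, rfl⟩⟩ : Set.range (Fin.castAdd (n := 5) 5)) =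
      Equiv.ofInjective _ (Fin.castAdd_injective 5 5) k := rfl
  rw [Equiv.trans_apply, this, Equiv.symm_apply_apply]
  rfl

/-- A code on which the first ten coordinates are injective has five of them as an
information set. -/
theorem exists_information_set {C : Submodule (ZMod 3) (Fin 12 → ZMod 3)}
    (hC : Module.finrank (ZMod 3) C = 5) (hx : ∀ c ∈ C, xPart c = 0 → c = 0) :
    ∃ s : Fin 5 → Fin 10, Function.Injective s ∧
      ∀ k, ∃ c ∈ C, ∀ j, xPart c (s j) = (Pi.single k 1 : Fin 5 → ZMod 3) j := by
  let φ : Fin 10 → Module.Dual (ZMod 3) C :=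
    fun i => (LinearMap.proj (Fin.castAdd 2 i)).comp C.subtype
  have hφ : Submodule.span (ZMod 3) (Set.range φ) = ⊤ := by
    rw [Submodule.eq_top_iff']
    refine fun ψ => mem_span_of_iInf_ker_le_ker fun c hc => ?_
    rw [Submodule.mem_iInf] at hc
    have : c = 0 := Subtype.ext (hx c c.2 (funext fun i => hc i))
    rw [this]
    exact Submodule.zero_mem _
  obtain ⟨f, hf, hspan, hli⟩ := Submodule.exists_fun_fin_finrank_span_eq (ZMod 3) (Set.range φ)
  have hn : Module.finrank (ZMod 3) (Submodule.span (ZMod 3) (Set.range φ)) = 5 := by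
    rw [hφ, finrank_top, Subspace.dual_finrank_eq, hC]
  revert f
  rw [hn]
  intro f hf hspan hli
  rw [hφ] at hspan
  choose s hs using hf
  let F : C →ₗ[ZMod 3] Fin 5 → ZMod 3 := LinearMap.pi f
  have hF : Function.Injective F := by
    rw [injective_iff_map_eq_zero]
    intro c hc
    have hall : ∀ ψ : Module.Dual (ZMod 3) C, ψ c = 0 := by
      intro ψ
      have hψ : ψ ∈ Submodule.span (ZMod 3) (Set.range f) := hspan ▸ Submodule.mem_top
      obtain ⟨m, rfl⟩ := (Submodule.mem_span_range_iff_exists_fun _).1 hψ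
      have h0 : ∀ i, f i c = 0 := fun i => congrFun hc i
      simp [h0]
    exact Subtype.ext (hx c c.2 (funext fun i => hall (φ i)))
  have hF' : Function.Surjective F :=
    (LinearMap.injective_iff_surjective_of_finrank_eq_finrank (by rw [hC]; simp)).1 hF
  refine ⟨s, fun i j h => hli.injective ?_, fun k => ?_⟩
  · rw [← hs, ← hs, h]
  · obtain ⟨c, hc⟩ := hF' (Pi.single k 1)
    refine ⟨c, c.2, fun j => ?_⟩
    rw [← hc]
    change _ = f j c
    rw [← hs]
    rfl

/-- The last seven coordinates of a vector, as natural numbers. -/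
def ofVec (v : Fin 12 → ZMod 3) : Row :=
  ⟨(v 10).val, (v 11).val, (v 5).val, (v 6).val, (v 7).val, (v 8).val, (v 9).val⟩

theorem ofVec_reduced (v : Fin 12 → ZMod 3) : (ofVec v).Reduced := by
  have h (x : ZMod 3) : x.val < 3 := ZMod.val_lt x
  exact ⟨h _, h _, h _, h _, h _, h _, h _⟩

theorem vec_ofVec {v : Fin 12 → ZMod 3} {m : Fin 5 → ℕ}
    (h : ∀ i, v (Fin.castAdd 7 i) = m i) : vec m (ofVec v) = v := by
  have h0 := h 0
  have h1 := h 1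
  have h2 := h 2
  have h3 := h 3
  have h4 := h 4
  have hv (x : ZMod 3) : (x.val : ZMod 3) = x := ZMod.natCast_zmod_val x
  funext j
  fin_cases j
  exacts [h0.symm, h1.symm, h2.symm, h3.symm, h4.symm, hv _, hv _, hv _, hv _, hv _, hv _, hv _]

theorem exists_szEquiv_code {C : Submodule (ZMod 3) (Fin 12 → ZMod 3)} (hC : IsSZCode C) :
    ∃ R : Fin 5 → Row, (∀ i, (R i).Reduced) ∧ SZEquiv C (code R) := by
  obtain ⟨s, hs, hc⟩ := exists_information_set hC.dim fun c hc h0 => by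
    by_contra hne
    have := hC.c2 c hc hne
    rw [xWeight, h0, hammingNorm_zero] at this
    omega
  obtain ⟨σ, hσ⟩ := exists_perm_extending s hs
  choose c hcC hc using hc
  refine ⟨fun k => ofVec (szMap 0 0 σ 1 (c k)), fun k => ofVec_reduced _,
    szEquiv_code hC.dim 0 0 σ 1 fun k => ⟨c k, hcC k, ?_⟩⟩
  rw [vec_ofVec, szLinear_apply]
  intro i
  have h := xPart_szMap 0 0 σ 1 (c k) (Fin.castAdd 5 i)
  rw [hσ, hc] at h
  refine Eq.trans h ?_
  by_cases hik : i = k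
  · subst hik; simp
  · simp [Pi.single_eq_of_ne hik]

/-- The negative of a digit. -/
def negDigit (n : ℕ) : ℕ := 2 * n % 3

theorem cast_negDigit (n : ℕ) : (negDigit n : ZMod 3) = -n := by
  rw [negDigit, ZMod.natCast_mod, Nat.cast_mul]
  have h3 : (3 : ZMod 3) = 0 := by decide
  push_cast
  linear_combination (n : ZMod 3) * h3

theorem negDigit_lt (n : ℕ) : negDigit n < 3 := Nat.mod_lt _ (by norm_num)

/-- The negative of a row. -/
def neg (r : Row) : Row :=
  ⟨negDigit r.s, negDigit r.t, negDigit r.a, negDigit r.b, negDigit r.c, negDigit r.d,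
    negDigit r.e⟩

/-- The last five x-coordinates. -/
def cols (r : Row) : Fin 5 → ℕ := ![r.a, r.b, r.c, r.d, r.e]

/-- The y-coordinates. -/
def ys (r : Row) : Fin 2 → ℕ := ![r.s, r.t]

theorem xPart_vec_castAdd (m : Fin 5 → ℕ) (r : Row) (i : Fin 5) :
    xPart (vec m r) (Fin.castAdd 5 i) = m i := by
  fin_cases i <;> rfl

theorem xPart_vec_natAdd (m : Fin 5 → ℕ) (r : Row) (i : Fin 5) :
    xPart (vec m r) (Fin.natAdd 5 i) = r.cols i := by
  fin_cases i <;> rfl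

theorem yPart_vec (m : Fin 5 → ℕ) (r : Row) (i : Fin 2) : yPart (vec m r) i = r.ys i := by
  fin_cases i <;> rfl

theorem natAdd_ne_castAdd (i j : Fin 5) : Fin.natAdd 5 i ≠ Fin.castAdd 5 j := by
  rw [ne_eq, Fin.ext_iff, Fin.val_natAdd, Fin.val_castAdd]
  omega

theorem szMap_eq {α : Fin 10 → Fin 2} {σ : Equiv.Perm (Fin 10)} {v w : Fin 12 → ZMod 3}
    (h : ∀ i : Fin 5,
      (-1) ^ (α (Fin.castAdd 5 i) : ℕ) * xPart v (σ (Fin.castAdd 5 i)) = xPart w (Fin.castAdd 5 i))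
    (h' : ∀ i : Fin 5,
      (-1) ^ (α (Fin.natAdd 5 i) : ℕ) * xPart v (σ (Fin.natAdd 5 i)) = xPart w (Fin.natAdd 5 i))
    (hy : ∀ i : Fin 2, yPart v i = yPart w i) :
    szMap α 0 σ 1 v = w := by
  apply ext_xPart_yPart <;> intro i
  · rw [xPart_szMap]
    exact Fin.addCases (m := 5) (n := 5) (motive := fun i =>
      (-1) ^ (α i : ℕ) * xPart v (σ i) = xPart w i) h h' i
  · rw [yPart_szMap, Fin.val_zero, pow_zero, one_mul]
    exact hy i

theorem code_map_szEquiv (R : Fin 5 → Row) (f : Row → Row) (α : Fin 10 → Fin 2)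
    (σ : Equiv.Perm (Fin 10)) (h : ∀ m r, szMap α 0 σ 1 (vec m r) = vec m (f r)) :
    SZEquiv (code R) (code fun i => f (R i)) :=
  code_szEquiv (finrank_code _) α 0 σ 1 fun i => by
    rw [h]
    exact vec_single_mem_code (fun i => f (R i)) i

theorem code_swap_cols_szEquiv (R : Fin 5 → Row) (f : Row → Row) (k l : Fin 5)
    (hf : ∀ r i, (f r).cols i = r.cols (Equiv.swap k l i)) (hy : ∀ r, (f r).ys = r.ys) :
    SZEquiv (code R) (code fun i => f (R i)) := by
  refine code_map_szEquiv R f 0 (Equiv.swap (Fin.natAdd 5 k) (Fin.natAdd 5 l)) fun m r =>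
    szMap_eq (fun i => ?_) (fun i => ?_) fun i => ?_
  · rw [Equiv.swap_apply_of_ne_of_ne (natAdd_ne_castAdd _ _).symm (natAdd_ne_castAdd _ _).symm,
      xPart_vec_castAdd, xPart_vec_castAdd, Pi.zero_apply, Fin.val_zero, pow_zero, one_mul]
  · rw [← (Fin.natAdd_injective 5 5).map_swap, xPart_vec_natAdd, xPart_vec_natAdd, hf,
      Pi.zero_apply, Fin.val_zero, pow_zero, one_mul]
  · rw [yPart_vec, yPart_vec, hy]

theorem code_neg_col_szEquiv (R : Fin 5 → Row) (f : Row → Row) (k : Fin 5)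
    (hf : ∀ r i, (f r).cols i = if i = k then negDigit (r.cols i) else r.cols i)
    (hy : ∀ r, (f r).ys = r.ys) :
    SZEquiv (code R) (code fun i => f (R i)) := by
  refine code_map_szEquiv R f (Pi.single (Fin.natAdd 5 k) 1) 1 fun m r =>
    szMap_eq (fun i => ?_) (fun i => ?_) fun i => ?_
  · rw [Pi.single_eq_of_ne (natAdd_ne_castAdd _ _).symm, Equiv.Perm.one_apply,
      xPart_vec_castAdd, xPart_vec_castAdd, Fin.val_zero, pow_zero, one_mul]
  · rw [Equiv.Perm.one_apply, xPart_vec_natAdd, xPart_vec_natAdd, hf]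
    by_cases hik : i = k
    · rw [if_pos hik, hik, Pi.single_eq_same, cast_negDigit, Fin.val_one, pow_one, neg_one_mul]
    · rw [if_neg hik, Pi.single_eq_of_ne fun h => hik (Fin.natAdd_injective 5 5 h), Fin.val_zero,
        pow_zero, one_mul]
  · rw [yPart_vec, yPart_vec, hy]

theorem cols_neg (r : Row) (i : Fin 5) : r.neg.cols i = negDigit (r.cols i) := by
  fin_cases i <;> rfl

theorem ys_neg (r : Row) (i : Fin 2) : r.neg.ys i = negDigit (r.ys i) := by
  fin_cases i <;> rfl

theorem xPart_neg (v : Fin 12 → ZMod 3) (i : Fin 10) : xPart (-v) i = -xPart v i := rfl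

theorem yPart_neg (v : Fin 12 → ZMod 3) (i : Fin 2) : yPart (-v) i = -yPart v i := rfl

theorem code_neg_row_szEquiv (R : Fin 5 → Row) (k : Fin 5) :
    SZEquiv (code R) (code (Function.update R k (R k).neg)) := by
  refine code_szEquiv (finrank_code _) (Pi.single (Fin.castAdd 5 k) 1) 0 1 1 fun i => ?_
  have hsingle : ∀ {i j : Fin 5}, i ≠ j → (Pi.single i 1 : Fin 5 → ℕ) j = 0 :=
    fun h => Pi.single_eq_of_ne h.symm _
  have h := vec_single_mem_code (Function.update R k (R k).neg) i
  by_cases hik : i = k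
  · subst hik
    have h := Submodule.neg_mem _ h
    rw [Function.update_self] at h
    convert h using 1
    refine szMap_eq (fun j => ?_) (fun j => ?_) fun j => ?_
    · rw [Equiv.Perm.one_apply, xPart_neg, xPart_vec_castAdd, xPart_vec_castAdd]
      by_cases hj : j = i
      · rw [hj, Pi.single_eq_same, Fin.val_one, pow_one, neg_one_mul]
      · rw [hsingle (Ne.symm hj), Nat.cast_zero, mul_zero, neg_zero]
    · rw [Equiv.Perm.one_apply, Pi.single_eq_of_ne (natAdd_ne_castAdd _ _), xPart_neg,
        xPart_vec_natAdd, xPart_vec_natAdd, cols_neg, cast_negDigit, Fin.val_zero, pow_zero,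
        one_mul, neg_neg]
    · rw [yPart_neg, yPart_vec, yPart_vec, ys_neg, cast_negDigit, neg_neg]
  · rw [Function.update_of_ne hik] at h
    convert h using 1
    refine szMap_eq (fun j => ?_) (fun j => ?_) fun _ => rfl
    · rw [Equiv.Perm.one_apply, xPart_vec_castAdd]
      by_cases hj : j = k
      · rw [hj, hsingle hik, Nat.cast_zero, mul_zero]
      · rw [Pi.single_eq_of_ne fun h => hj (Fin.castAdd_injective 5 5 h), Fin.val_zero, pow_zero,
          one_mul]
    · rw [Equiv.Perm.one_apply, Pi.single_eq_of_ne (natAdd_ne_castAdd _ _), Fin.val_zero, pow_zero,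
        one_mul]

theorem code_swap_rows_szEquiv (R : Fin 5 → Row) (k l : Fin 5) :
    SZEquiv (code R) (code (R ∘ Equiv.swap k l)) := by
  refine code_szEquiv (finrank_code _) 0 0 (Equiv.swap (Fin.castAdd 5 k) (Fin.castAdd 5 l)) 1
    fun i => ?_
  have h := vec_single_mem_code (R ∘ Equiv.swap k l) (Equiv.swap k l i)
  rw [Function.comp_apply, Equiv.swap_apply_self] at h
  convert h using 1
  refine szMap_eq (fun j => ?_) (fun j => ?_) fun j => ?_
  · rw [← (Fin.castAdd_injective 5 5).map_swap, xPart_vec_castAdd, xPart_vec_castAdd,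
      Pi.zero_apply, Fin.val_zero, pow_zero, one_mul]
    congr 1
    by_cases hj : j = Equiv.swap k l i
    · rw [hj, Equiv.swap_apply_self, Pi.single_eq_same, Pi.single_eq_same]
    · rw [Pi.single_eq_of_ne hj, Pi.single_eq_of_ne]
      rintro rfl
      exact hj (Equiv.swap_apply_self _ _ _).symm
  · rw [Equiv.swap_apply_of_ne_of_ne (natAdd_ne_castAdd _ _) (natAdd_ne_castAdd _ _),
      Pi.zero_apply, Fin.val_zero, pow_zero, one_mul, xPart_vec_natAdd, xPart_vec_natAdd]
  · rw [yPart_vec, yPart_vec]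

/-- The digits of a row, the most significant one first. -/
def digits (r : Row) : List ℕ := [r.s, r.t, r.a, r.b, r.c, r.d, r.e]

theorem key_eq (r : Row) :
    r.key = 3 * (3 * (3 * (3 * (3 * (3 * r.s + r.t) + r.a) + r.b) + r.c) + r.d) + r.e := rfl

theorem eq_of_key_eq {r x : Row} (hr : r.Reduced) (hx : x.Reduced) (h : r.key = x.key) : r = x := by
  obtain ⟨h1, h2, h3, h4, h5, h6, h7⟩ := hr
  obtain ⟨k1, k2, k3, k4, k5, k6, k7⟩ := hx
  rw [key_eq, key_eq] at h
  cases r; cases x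
  simp only [mk.injEq] at *
  omega

/-- The matrix `R` is the smallest one in its class: its rows, read as numbers in base 3,
are lexicographically minimal. -/
structure IsMinimal (R : Fin 5 → Row) : Prop where
  reduced : ∀ i, (R i).Reduced
  minimal : ∀ R' : Fin 5 → Row, (∀ i, (R' i).Reduced) → SZEquiv (code R) (code R') →
    ¬ toLex (fun i => (R' i).key) < toLex (fun i => (R i).key)

theorem exists_isMinimal {C : Submodule (ZMod 3) (Fin 12 → ZMod 3)} (hC : IsSZCode C) :
    ∃ R : Fin 5 → Row, IsMinimal R ∧ SZEquiv C (code R) := by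
  let S : Set (Lex (Fin 5 → ℕ)) :=
    {x | ∃ R : Fin 5 → Row, (∀ i, (R i).Reduced) ∧ SZEquiv C (code R) ∧
      toLex (fun i => (R i).key) = x}
  have hS : S.Nonempty := by
    obtain ⟨R, hR, h⟩ := exists_szEquiv_code hC
    exact ⟨_, R, hR, h, rfl⟩
  have hwf : WellFounded ((· < ·) : Lex (Fin 5 → ℕ) → Lex (Fin 5 → ℕ) → Prop) :=
    (Pi.Lex.wellFoundedLT (α := fun _ : Fin 5 => ℕ)).wf
  obtain ⟨_, ⟨R, hR, h, rfl⟩, hmin⟩ := hwf.has_min S hS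
  exact ⟨R, ⟨hR, fun R' hR' h' => hmin _ ⟨R', hR', h.trans h', rfl⟩⟩, h⟩

namespace IsMinimal

variable {R : Fin 5 → Row}

theorem le_key_of_eq_before (hR : IsMinimal R) {R' : Fin 5 → Row} (h' : ∀ i, (R' i).Reduced)
    (h : SZEquiv (code R) (code R')) (i : Fin 5) (hi : ∀ j < i, R' j = R j) :
    (R i).key ≤ (R' i).key := by
  by_contra hlt
  exact hR.minimal R' h' h ⟨i, fun j hj => congrArg key (hi j hj), not_le.1 hlt⟩

theorem key_le (hR : IsMinimal R) {i j : Fin 5} (hij : i < j) : (R i).key ≤ (R j).key := by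
  have := hR.le_key_of_eq_before (fun _ => hR.reduced _) (code_swap_rows_szEquiv R i j) i
    fun k hk => congrArg R (Equiv.swap_apply_of_ne_of_ne hk.ne (hk.trans hij).ne)
  change _ ≤ (R (Equiv.swap i j i)).key at this
  rwa [Equiv.swap_apply_left] at this

theorem neg_reduced (r : Row) : r.neg.Reduced :=
  ⟨negDigit_lt _, negDigit_lt _, negDigit_lt _, negDigit_lt _, negDigit_lt _, negDigit_lt _,
    negDigit_lt _⟩

theorem negDigit_zero : negDigit 0 = 0 := rfl

theorem negDigit_two : negDigit 2 = 1 := rfl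

theorem le_foldl_digits (l : List ℕ) (n : ℕ) :
    n * 3 ^ l.length ≤ l.foldl (fun n k => 3 * n + k) n := by
  induction l generalizing n with
  | nil => simp
  | cons a l ih =>
    refine le_trans ?_ (ih (3 * n + a))
    rw [List.length_cons, pow_succ]
    nlinarith [Nat.zero_le (a * 3 ^ l.length)]

theorem foldl_digits_lt (l : List ℕ) (hl : ∀ a ∈ l, a < 3) (n : ℕ) :
    l.foldl (fun n k => 3 * n + k) n < (n + 1) * 3 ^ l.length := by
  induction l generalizing n with
  | nil => simp
  | cons a l ih =>
    refine lt_of_lt_of_le (ih (fun b hb => hl b (List.mem_cons_of_mem _ hb)) (3 * n + a)) ?_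
    have ha := hl a List.mem_cons_self
    rw [List.length_cons, pow_succ, mul_comm (3 ^ l.length) 3, ← mul_assoc]
    exact Nat.mul_le_mul_right _ (by omega)

theorem leadOK_of_foldl_le (l : List ℕ) (hl : ∀ a ∈ l, a < 3) (n : ℕ)
    (h : l.foldl (fun n k => 3 * n + k) n ≤ (l.map negDigit).foldl (fun n k => 3 * n + k) n) :
    leadOK l = true := by
  induction l generalizing n with
  | nil => rfl
  | cons a l ih =>
    have hl' : ∀ b ∈ l, b < 3 := fun b hb => hl b (List.mem_cons_of_mem _ hb)
    have ha := hl a List.mem_cons_self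
    rw [List.map_cons, List.foldl_cons, List.foldl_cons] at h
    interval_cases a
    · exact ih hl' _ h
    · rfl
    · rw [negDigit_two] at h
      have h1 := le_foldl_digits l (3 * n + 2)
      have h2 := foldl_digits_lt (l.map negDigit) (by simp [negDigit_lt]) (3 * n + 1)
      rw [List.length_map] at h2
      exact absurd h (not_le.2 (h2.trans_le h1))

theorem leadOK_digits (hR : IsMinimal R) (i : Fin 5) : leadOK (R i).digits = true := by
  have h := hR.le_key_of_eq_before (R' := Function.update R i (R i).neg) (fun j => by
    by_cases hj : j = i
    · rw [hj, Function.update_self]; exact neg_reduced _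
    · rw [Function.update_of_ne hj]; exact hR.reduced j) (code_neg_row_szEquiv R i) i
    fun j hj => Function.update_of_ne hj.ne _ _
  rw [Function.update_self] at h
  obtain ⟨h1, h2, h3, h4, h5, h6, h7⟩ := hR.reduced i
  exact leadOK_of_foldl_le _ (by simp [digits, h1, h2, h3, h4, h5, h6, h7]) 0
    (by simpa [digits, key_eq, neg] using h)

theorem le_key_swap_cols (hR : IsMinimal R) (f : Row → Row) (k l : Fin 5)
    (hf : ∀ r i, (f r).cols i = r.cols (Equiv.swap k l i)) (hy : ∀ r, (f r).ys = r.ys)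
    (hf3 : ∀ r, r.Reduced → (f r).Reduced) (i : Fin 5) (hi : ∀ j < i, f (R j) = R j) :
    (R i).key ≤ (f (R i)).key :=
  hR.le_key_of_eq_before (R' := fun i => f (R i)) (fun i => hf3 _ (hR.reduced i))
    (code_swap_cols_szEquiv R f k l hf hy) i hi

theorem le_key_neg_col (hR : IsMinimal R) (f : Row → Row) (k : Fin 5)
    (hf : ∀ r i, (f r).cols i = if i = k then negDigit (r.cols i) else r.cols i)
    (hy : ∀ r, (f r).ys = r.ys)
    (hf3 : ∀ r, r.Reduced → (f r).Reduced) (i : Fin 5) (hi : ∀ j < i, f (R j) = R j) :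
    (R i).key ≤ (f (R i)).key :=
  hR.le_key_of_eq_before (R' := fun i => f (R i)) (fun i => hf3 _ (hR.reduced i))
    (code_neg_col_szEquiv R f k hf hy) i hi

/-- A column is lexicographically at most another one. -/
def ColumnsLE (u v : Row → ℕ) (R : Fin 5 → Row) : Prop :=
  ∀ i, (∀ j < i, u (R j) = v (R j)) → u (R i) ≤ v (R i)

/-- The first nonzero entry of a column is not `2`. -/
def ColumnNormalized (u : Row → ℕ) (R : Fin 5 → Row) : Prop :=
  ∀ i, (∀ j < i, u (R j) = 0) → u (R i) ≠ 2

theorem columnsLE_ab (hR : IsMinimal R) : ColumnsLE a b R := fun i hi => by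
  have h := hR.le_key_swap_cols (fun r => ⟨r.s, r.t, r.b, r.a, r.c, r.d, r.e⟩) 0 1
    (fun r i => by fin_cases i <;> rfl) (fun _ => rfl)
    (fun r ⟨h1, h2, h3, h4, h5, h6, h7⟩ => ⟨h1, h2, h4, h3, h5, h6, h7⟩) i
    fun j hj => congrArg₂ (fun x y => (⟨(R j).s, (R j).t, x, y, (R j).c, (R j).d, (R j).e⟩ : Row))
      (hi j hj).symm (hi j hj)
  simp only [key_eq] at h
  omega

theorem columnsLE_bc (hR : IsMinimal R) : ColumnsLE b c R := fun i hi => by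
  have h := hR.le_key_swap_cols (fun r => ⟨r.s, r.t, r.a, r.c, r.b, r.d, r.e⟩) 1 2
    (fun r i => by fin_cases i <;> rfl) (fun _ => rfl)
    (fun r ⟨h1, h2, h3, h4, h5, h6, h7⟩ => ⟨h1, h2, h3, h5, h4, h6, h7⟩) i
    fun j hj => congrArg₂ (fun x y => (⟨(R j).s, (R j).t, (R j).a, x, y, (R j).d, (R j).e⟩ : Row))
      (hi j hj).symm (hi j hj)
  simp only [key_eq] at h
  omega

theorem columnsLE_cd (hR : IsMinimal R) : ColumnsLE c d R := fun i hi => by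
  have h := hR.le_key_swap_cols (fun r => ⟨r.s, r.t, r.a, r.b, r.d, r.c, r.e⟩) 2 3
    (fun r i => by fin_cases i <;> rfl) (fun _ => rfl)
    (fun r ⟨h1, h2, h3, h4, h5, h6, h7⟩ => ⟨h1, h2, h3, h4, h6, h5, h7⟩) i
    fun j hj => congrArg₂ (fun x y => (⟨(R j).s, (R j).t, (R j).a, (R j).b, x, y, (R j).e⟩ : Row))
      (hi j hj).symm (hi j hj)
  simp only [key_eq] at h
  omega

theorem columnsLE_de (hR : IsMinimal R) : ColumnsLE d e R := fun i hi => by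
  have h := hR.le_key_swap_cols (fun r => ⟨r.s, r.t, r.a, r.b, r.c, r.e, r.d⟩) 3 4
    (fun r i => by fin_cases i <;> rfl) (fun _ => rfl)
    (fun r ⟨h1, h2, h3, h4, h5, h6, h7⟩ => ⟨h1, h2, h3, h4, h5, h7, h6⟩) i
    fun j hj => congrArg₂ (fun x y => (⟨(R j).s, (R j).t, (R j).a, (R j).b, (R j).c, x, y⟩ : Row))
      (hi j hj).symm (hi j hj)
  simp only [key_eq] at h
  omega

theorem columnNormalized_a (hR : IsMinimal R) : ColumnNormalized a R := fun i hi h2 => by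
  have h := hR.le_key_neg_col (fun r => ⟨r.s, r.t, negDigit r.a, r.b, r.c, r.d, r.e⟩) 0
    (fun r i => by fin_cases i <;> rfl) (fun _ => rfl)
    (fun r ⟨h1, h2, _, h4, h5, h6, h7⟩ => ⟨h1, h2, negDigit_lt _, h4, h5, h6, h7⟩) i
    fun j hj => by simp only [hi j hj]; rw [negDigit_zero, ← hi j hj]
  simp only [key_eq, h2, negDigit_two] at h
  omega

theorem columnNormalized_b (hR : IsMinimal R) : ColumnNormalized b R := fun i hi h2 => by
  have h := hR.le_key_neg_col (fun r => ⟨r.s, r.t, r.a, negDigit r.b, r.c, r.d, r.e⟩) 1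
    (fun r i => by fin_cases i <;> rfl) (fun _ => rfl)
    (fun r ⟨h1, h2, h3, _, h5, h6, h7⟩ => ⟨h1, h2, h3, negDigit_lt _, h5, h6, h7⟩) i
    fun j hj => by simp only [hi j hj]; rw [negDigit_zero, ← hi j hj]
  simp only [key_eq, h2, negDigit_two] at h
  omega

theorem columnNormalized_c (hR : IsMinimal R) : ColumnNormalized c R := fun i hi h2 => by
  have h := hR.le_key_neg_col (fun r => ⟨r.s, r.t, r.a, r.b, negDigit r.c, r.d, r.e⟩) 2
    (fun r i => by fin_cases i <;> rfl) (fun _ => rfl)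
    (fun r ⟨h1, h2, h3, h4, _, h6, h7⟩ => ⟨h1, h2, h3, h4, negDigit_lt _, h6, h7⟩) i
    fun j hj => by simp only [hi j hj]; rw [negDigit_zero, ← hi j hj]
  simp only [key_eq, h2, negDigit_two] at h
  omega

theorem columnNormalized_d (hR : IsMinimal R) : ColumnNormalized d R := fun i hi h2 => by
  have h := hR.le_key_neg_col (fun r => ⟨r.s, r.t, r.a, r.b, r.c, negDigit r.d, r.e⟩) 3
    (fun r i => by fin_cases i <;> rfl) (fun _ => rfl)
    (fun r ⟨h1, h2, h3, h4, h5, _, h7⟩ => ⟨h1, h2, h3, h4, h5, negDigit_lt _, h7⟩) i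
    fun j hj => by simp only [hi j hj]; rw [negDigit_zero, ← hi j hj]
  simp only [key_eq, h2, negDigit_two] at h
  omega

theorem columnNormalized_e (hR : IsMinimal R) : ColumnNormalized e R := fun i hi h2 => by
  have h := hR.le_key_neg_col (fun r => ⟨r.s, r.t, r.a, r.b, r.c, r.d, negDigit r.e⟩) 4
    (fun r i => by fin_cases i <;> rfl) (fun _ => rfl)
    (fun r ⟨h1, h2, h3, h4, h5, h6, _⟩ => ⟨h1, h2, h3, h4, h5, h6, negDigit_lt _⟩) i
    fun j hj => by simp only [hi j hj]; rw [negDigit_zero, ← hi j hj]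
  simp only [key_eq, h2, negDigit_two] at h
  omega

/-- The columns of the first `n` rows, as numbers in base 3. -/
def columnDigits (R : Fin 5 → Row) : ℕ → Row
  | 0 => zero
  | n + 1 => comb 3 (R (Fin.ofNat 5 n)) (columnDigits R n)

theorem eq_of_columnDigits_eq {u v : Row → ℕ} (hu : ∀ r x, u (comb 3 r x) = u r + 3 * u x)
    (hv : ∀ r x, v (comb 3 r x) = v r + 3 * v x) (hu3 : ∀ i, u (R i) < 3) (hv3 : ∀ i, v (R i) < 3)
    {n : ℕ} (h : u (columnDigits R n) = v (columnDigits R n)) :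
    ∀ k < n, u (R (Fin.ofNat 5 k)) = v (R (Fin.ofNat 5 k)) := by
  induction n with
  | zero => exact fun k hk => absurd hk k.not_lt_zero
  | succ n ih =>
    rw [columnDigits, hu, hv] at h
    have := hu3 (Fin.ofNat 5 n)
    have := hv3 (Fin.ofNat 5 n)
    intro k hk
    rcases Nat.lt_succ_iff_lt_or_eq.1 hk with hk | rfl
    · exact ih (by omega) k hk
    · omega

theorem digitOK_columnDigits {u v : Row → ℕ} (hu : ∀ r x, u (comb 3 r x) = u r + 3 * u x)
    (hv : ∀ r x, v (comb 3 r x) = v r + 3 * v x) (hu3 : ∀ i, u (R i) < 3) (hv3 : ∀ i, v (R i) < 3)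
    (hle : ColumnsLE u v R) (hn : ColumnNormalized v R) (i : Fin 5) :
    digitOK (v (columnDigits R i)) (u (columnDigits R i)) (u (R i)) (v (R i)) = true := by
  have hofNat : ∀ j : Fin 5, Fin.ofNat 5 j = j := fun j => by simp
  simp only [digitOK, Bool.and_eq_true, Bool.not_eq_true', ← Bool.not_eq_true, Nat.beq_eq,
    Nat.blt_eq, not_and]
  constructor
  · intro h0
    refine hn i fun j hj => ?_
    have := eq_of_columnDigits_eq (v := fun _ => 0) hv (fun _ _ => rfl) hv3 (fun _ => by norm_num)
      h0 j hj
    rwa [hofNat] at this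
  · intro he
    refine not_lt.2 (hle i fun j hj => ?_)
    have := eq_of_columnDigits_eq hv hu hv3 hu3 he j hj
    rw [hofNat] at this
    exact this.symm

theorem columnsOK_columnDigits (hR : IsMinimal R) (i : Fin 5) :
    columnsOK (columnDigits R i) (R i) = true := by
  have h3 : ∀ i, (R i).a < 3 := fun i => (hR.reduced i).2.2.1
  have h4 : ∀ i, (R i).b < 3 := fun i => (hR.reduced i).2.2.2.1
  have h5 : ∀ i, (R i).c < 3 := fun i => (hR.reduced i).2.2.2.2.1
  have h6 : ∀ i, (R i).d < 3 := fun i => (hR.reduced i).2.2.2.2.2.1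
  have h7 : ∀ i, (R i).e < 3 := fun i => (hR.reduced i).2.2.2.2.2.2
  simp only [columnsOK, Bool.and_eq_true]
  exact ⟨digitOK_columnDigits (u := a) (v := a) (fun _ _ => rfl) (fun _ _ => rfl) h3 h3 (fun _ _ => le_rfl)
      hR.columnNormalized_a i,
    digitOK_columnDigits (u := a) (v := b) (fun _ _ => rfl) (fun _ _ => rfl) h3 h4 hR.columnsLE_ab hR.columnNormalized_b i,
    digitOK_columnDigits (u := b) (v := c) (fun _ _ => rfl) (fun _ _ => rfl) h4 h5 hR.columnsLE_bc hR.columnNormalized_c i,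
    digitOK_columnDigits (u := c) (v := d) (fun _ _ => rfl) (fun _ _ => rfl) h5 h6 hR.columnsLE_cd hR.columnNormalized_d i,
    digitOK_columnDigits (u := d) (v := e) (fun _ _ => rfl) (fun _ _ => rfl) h6 h7 hR.columnsLE_de hR.columnNormalized_e i⟩

end IsMinimal

theorem nz_single_add (i : Fin 5) : nz ((Pi.single i 1 : Fin 5 → ℕ) 0) +
    nz ((Pi.single i 1 : Fin 5 → ℕ) 1) + nz ((Pi.single i 1 : Fin 5 → ℕ) 2) +
    nz ((Pi.single i 1 : Fin 5 → ℕ) 3) + nz ((Pi.single i 1 : Fin 5 → ℕ) 4) = 1 := by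
  revert i; decide

theorem c1_c23_of_mem {C : Submodule (ZMod 3) (Fin 12 → ZMod 3)} (hC : IsSZCode C)
    {m : Fin 5 → ℕ} {r : Row} (h : vec m r ∈ C) {n : ℕ} (hn : n ≠ 0)
    (hm : nz (m 0) + nz (m 1) + nz (m 2) + nz (m 3) + nz (m 4) = n) :
    c1 (n + r.weight) r = true ∧ c23 (n + r.weight) r = true := by
  have hw := xWeight_vec m r
  rw [hm] at hw
  rw [c1_eq_true, c23_eq_true, ← hw]
  refine ⟨hC.c1 _ h, hC.c2 _ h fun h0 => ?_, hC.c3 _ h⟩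
  rw [h0] at hw
  have : xWeight 0 = 0 := hammingNorm_zero
  omega

theorem c1_c23_row {R : Fin 5 → Row} (hR : IsSZCode (code R)) (i : Fin 5) :
    c1 (1 + (R i).weight) (R i) = true ∧ c23 (1 + (R i).weight) (R i) = true :=
  c1_c23_of_mem hR (vec_single_mem_code R i) one_ne_zero (nz_single_add i)

theorem c1_c23_comb {R : Fin 5 → Row} (hR : IsSZCode (code R)) {i j : Fin 5} (hij : i ≠ j) {k : ℕ}
    (hk : k = 1 ∨ k = 2) : c1 (2 + (comb k (R i) (R j)).weight) (comb k (R i) (R j)) = true ∧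
      c23 (2 + (comb k (R i) (R j)).weight) (comb k (R i) (R j)) = true := by
  have h := Submodule.add_mem _ (vec_single_mem_code R i)
    (Submodule.smul_mem _ (k : ZMod 3) (vec_single_mem_code R j))
  rw [← vec_comb] at h
  refine c1_c23_of_mem hR h two_ne_zero ?_
  rcases hk with rfl | rfl <;> clear h <;> revert i j <;> decide

theorem cast_nz (n : ℕ) : (nz n : ZMod 3) = n * n := by
  rw [← Nat.cast_mul, ← ZMod.natCast_mod (n * n)]
  rfl

theorem cast_weight (r : Row) :
    (r.weight : ZMod 3) = r.a * r.a + r.b * r.b + r.c * r.c + r.d * r.d + r.e * r.e := by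
  simp only [weight, Nat.add_eq, Nat.cast_add, cast_nz, add_assoc]

theorem cast_form (r x : Row) : (form r x : ZMod 3) =
    r.a * x.a + r.b * x.b + r.c * x.c + r.d * x.d + r.e * x.e + r.s * x.t + r.t * x.s := by
  simp only [form, Nat.add_eq, Nat.mul_eq, Nat.cast_add, Nat.cast_mul, add_assoc]

theorem form_eq_zero {r x : Row} (hr : c1 (1 + r.weight) r = true)
    (hx : c1 (1 + x.weight) x = true) (h : c1 (2 + (comb 1 r x).weight) (comb 1 r x) = true) :
    (form r x : ZMod 3) = 0 := by
  rw [c1_eq_true, Nat.cast_add, cast_weight] at hr hx h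
  simp only [comb, Nat.add_eq, Nat.mul_eq, one_mul, Nat.cast_add, Nat.cast_one,
    Nat.cast_ofNat] at hr hx h
  have h3 : (3 : ZMod 3) = 0 := by decide
  rw [cast_form]
  linear_combination 2 * h - 2 * hr - 2 * hx - (r.a * x.a + r.b * x.b + r.c * x.c + r.d * x.d +
    r.e * x.e - r.s * x.t - r.t * x.s : ZMod 3) * h3

theorem key_ne {R : Fin 5 → Row} (hR : IsSZCode (code R)) (hr : ∀ i, (R i).Reduced) {i j : Fin 5}
    (hij : i ≠ j) : (R i).key ≠ (R j).key := by
  intro h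
  have h2 := (c1_c23_comb hR hij (Or.inr rfl)).2
  rw [eq_of_key_eq (hr i) (hr j) h, c23_eq_true] at h2
  have hw : (comb 2 (R j) (R j)).weight = 0 := by
    have : ∀ n, nz (n + 2 * n) = 0 := fun n => by
      rw [nz_eq, if_neg]
      rw [not_not, ZMod.natCast_eq_zero_iff]
      exact ⟨n, by ring⟩
    simp only [weight, comb, Nat.add_eq, Nat.mul_eq, this]
  omega

theorem compat_of_lt {R : Fin 5 → Row} (hR : IsSZCode (code R)) (hm : IsMinimal R) {i j : Fin 5}
    (hij : i < j) : compat (R i) (R j) = true := by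
  have h1 := c1_c23_comb hR hij.ne (Or.inl rfl)
  have h2 := c1_c23_comb hR hij.ne (Or.inr rfl)
  have hf := form_eq_zero (c1_c23_row hR i).1 (c1_c23_row hR j).1 h1.1
  rw [ZMod.natCast_eq_zero_iff] at hf
  rw [compat, Bool.and_eq_true, Bool.and_eq_true, Bool.and_eq_true, Nat.beq_eq, Nat.blt_eq]
  exact ⟨Nat.mod_eq_zero_of_dvd hf, lt_of_le_of_ne (hm.key_le hij) (key_ne hR hm.reduced hij.ne),
    h1.2, h2.2⟩

theorem single_of_isMinimal {R : Fin 5 → Row} (hR : IsSZCode (code R)) (hm : IsMinimal R)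
    (i : Fin 5) : single (R i) = true := by
  rw [single, Bool.and_eq_true, Bool.and_eq_true, Nat.succ_eq_one_add]
  exact ⟨c1_c23_row hR i, hm.leadOK_digits i⟩

theorem mem_all {r : Row} (hr : r.Reduced) (h : leadOK r.digits = true) : r ∈ all := by
  obtain ⟨h1, h2, h3, h4, h5, h6, h7⟩ := hr
  have hs : r.s ≠ 2 := by
    intro h2
    rw [digits, leadOK, h2] at h
    exact Bool.noConfusion h
  have h01 : ∀ n, n < 3 → n ∈ [0, 1, 2] := by decide
  simp only [all, List.mem_flatMap, List.mem_map]
  refine ⟨r.s, ?_, r.t, h01 _ h2, r.a, h01 _ h3, r.b, h01 _ h4, r.c, h01 _ h5, r.d, h01 _ h6,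
    r.e, h01 _ h7, rfl⟩
  simp only [List.mem_cons, List.not_mem_nil]
  omega

theorem exists_of_filterThen {p : Row → Bool} {k : List Row → Bool} {l acc : List Row}
    (h : filterThen p k l acc = true) :
    ∃ l', k l' = true ∧ (∀ x ∈ acc, x ∈ l') ∧ ∀ x ∈ l, p x = true → x ∈ l' := by
  induction l generalizing acc with
  | nil => exact ⟨acc, h, fun _ hx => hx, by simp⟩
  | cons y l ih =>
    rw [filterThen] at h
    cases hy : p y with
    | true =>
      rw [hy] at h
      obtain ⟨l', hk, hacc, hl⟩ := ih h
      refine ⟨l', hk, fun x hx => hacc x (List.mem_cons_of_mem _ hx), fun x hx hp => ?_⟩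
      rcases List.mem_cons.1 hx with rfl | hx
      · exact hacc _ List.mem_cons_self
      · exact hl x hx hp
    | false =>
      rw [hy] at h
      obtain ⟨l', hk, hacc, hl⟩ := ih h
      refine ⟨l', hk, hacc, fun x hx hp => ?_⟩
      rcases List.mem_cons.1 hx with rfl | hx
      · exact absurd hp (by simp [hy])
      · exact hl x hx hp

/-- The columns remain sorted and normalized if the given rows are appended one by one. -/
def ColumnsChain : Row → List Row → Prop
  | _, [] => True
  | p, r :: l => columnsOK p r = true ∧ ColumnsChain (comb 3 r p) l

theorem leaf_of_search {leaf : List Row → Bool} {n : ℕ} {rows : List Row} {p : Row}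
    {cands : List Row} (h : search leaf n rows p cands = true) {l : List Row} (hn : l.length = n)
    (hl : ∀ r ∈ l, r ∈ cands) (hc : l.Pairwise fun r x => compat r x = true)
    (hp : ColumnsChain p l) : leaf (l.reverse ++ rows) = true := by
  induction n generalizing rows p cands l with
  | zero =>
    rw [List.length_eq_zero_iff] at hn
    subst hn
    exact h
  | succ n ih =>
    obtain _ | ⟨r, l⟩ := l
    · simp at hn
    rw [search, List.all_eq_true] at h
    have hr := h r (hl r List.mem_cons_self)
    rw [hp.1, Bool.not_true, Bool.false_or] at hr
    obtain ⟨cands', hk, -, hcands⟩ := exists_of_filterThen hr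
    rw [List.pairwise_cons] at hc
    rw [List.reverse_cons, List.append_assoc]
    exact ih hk (Nat.succ.inj hn)
      (fun x hx => hcands x (hl x (List.mem_cons_of_mem _ hx)) (hc.1 x hx)) hc.2 hp.2

theorem leaf_of_isMinimal {leaf : List Row → Bool}
    (h : filterThen single (search leaf 5 [] zero) all [] = true) {R : Fin 5 → Row}
    (hR : IsSZCode (code R)) (hm : IsMinimal R) : leaf [R 4, R 3, R 2, R 1, R 0] = true := by
  obtain ⟨l, hl, -, hall⟩ := exists_of_filterThen h
  have hmem : ∀ i, R i ∈ l := fun i =>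
    hall _ (mem_all (hm.reduced i) (hm.leadOK_digits i)) (single_of_isMinimal hR hm i)
  have hcol := hm.columnsOK_columnDigits
  refine leaf_of_search hl (l := [R 0, R 1, R 2, R 3, R 4]) rfl (by simp [hmem]) ?_
    ⟨hcol 0, hcol 1, hcol 2, hcol 3, hcol 4, trivial⟩
  have hlt : ∀ {i j : Fin 5}, i < j → compat (R i) (R j) = true := compat_of_lt hR hm
  simp only [List.pairwise_cons, List.mem_cons, List.not_mem_nil, or_false, forall_eq_or_imp,
    forall_eq, false_imp_iff, implies_true, and_true, List.Pairwise.nil]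
  refine ⟨⟨hlt ?_, hlt ?_, hlt ?_, hlt ?_⟩, ⟨hlt ?_, hlt ?_, hlt ?_⟩, ⟨hlt ?_, hlt ?_⟩, hlt ?_⟩ <;>
    decide

/-- The x-coordinate with index `n` of the generator with index `k` and row `r`. -/
def coord (k : ℕ) (r : Row) : ℕ → ℕ
  | 5 => r.a
  | 6 => r.b
  | 7 => r.c
  | 8 => r.d
  | 9 => r.e
  | n => bif Nat.beq k n then 1 else 0

/-- The digit with index `j` of the base 20 number `n`. -/
def digit (n j : ℕ) : ℕ := Nat.mod (Nat.div n (Nat.pow 20 j)) 20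

/-- The x-coordinate with index `j` of the image of the generator with index `k` and row `r`. The
base 20 digits of `n` encode the source and the sign of the first ten coordinates. -/
def imageCoord (n k : ℕ) (r : Row) (j : ℕ) : ℕ :=
  Nat.mul (Nat.succ (Nat.div (digit n j) 10)) (coord k r (Nat.mod (digit n j) 10))

/-- The exponent of the sign on the y-part. -/
def ySign (n : ℕ) : ℕ := Nat.mod (Nat.div (digit n 10) 2) 2

/-- Whether the two coordinates of the y-part are swapped. -/
def ySwap (n : ℕ) : Bool := Nat.beq (Nat.mod (digit n 10) 2) 1

/-- The last coordinates of the image of the generator with index `k` and row `r`. -/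
def imageRow (n k : ℕ) (r : Row) : Row :=
  ⟨Nat.mul (Nat.succ (ySign n)) (bif ySwap n then r.t else r.s),
    Nat.mul (Nat.succ (ySign n)) (bif ySwap n then r.s else r.t),
    imageCoord n k r 5, imageCoord n k r 6, imageCoord n k r 7, imageCoord n k r 8,
    imageCoord n k r 9⟩

/-- Equality modulo 3. -/
def modEq (m n : ℕ) : Bool := Nat.beq (Nat.mod m 3) (Nat.mod n 3)

/-- Equality of rows modulo 3. -/
def rowModEq (r x : Row) : Bool :=
  modEq r.a x.a && (modEq r.b x.b && (modEq r.c x.c && (modEq r.d x.d && (modEq r.e x.e &&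
    (modEq r.s x.s && modEq r.t x.t)))))

/-- The target code encoded in `n`. -/
def targetIndex (n : ℕ) : Fin 7 := ⟨Nat.mod (digit n 11) 7, Nat.mod_lt _ (by norm_num)⟩

/-- The map encoded in `n` takes the generator with index `k` and row `r` to the code with
generators `T`. -/
def imageOK (n : ℕ) (T : Fin 5 → Row) (k : ℕ) (r : Row) : Bool :=
  rowModEq (imageRow n k r) (combo T (imageCoord n k r 0) (imageCoord n k r 1) (imageCoord n k r 2)
    (imageCoord n k r 3) (imageCoord n k r 4))

/-- The digits of `n` encode a permutation of the first ten coordinates. -/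
def isPerm (n : ℕ) : Bool :=
  (List.range 10).all fun i => (List.range 10).any fun j => Nat.beq (Nat.mod (digit n j) 10) i

/-- The map encoded in `n` takes the code with the given generators to its target code. -/
def certifiesMap (n : ℕ) (r₀ r₁ r₂ r₃ r₄ : Row) : Bool :=
  imageOK n (target (targetIndex n)) 4 r₄ && (imageOK n (target (targetIndex n)) 3 r₃ &&
    (imageOK n (target (targetIndex n)) 2 r₂ && (imageOK n (target (targetIndex n)) 1 r₁ &&
      (imageOK n (target (targetIndex n)) 0 r₀ && isPerm n))))

/-- The number `n % 2187` is the key of the last generator, and the map encoded in `n / 2187` takes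
the code with the given generators, the last one coming first, to its target code. -/
def certifies (n : ℕ) : List Row → Bool
  | [r₄, r₃, r₂, r₁, r₀] =>
    Nat.beq (Nat.mod n 2187) r₄.key && certifiesMap (Nat.div n 2187) r₀ r₁ r₂ r₃ r₄
  | _ => false

/-- Equivalences of the codes with minimal generator matrices to the seven codes. -/
def certificates : List ℕ := [
  2253878006653978539, 2701775609803260652, 2258021132942252379, 2705941057348366265, 2253900401044092411,
  2258043527332366265, 2702895353452903279, 2246823692942293959, 2242367038198697307, 2244584130758846849,
  2243485522644139410, 2702637813588918988, 2702637811839537913, 1806822802676756812, 1805759048669118171,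
  2247408544888669956, 2246599669955795977, 2240966097942136159, 1350829504386719921, 1351868289987827425,
  1351610749083564056, 1797880800030354429, 1797864706835183542, 1805327800262497361, 1350829524315538577,
  1351610749033700280, 1351868290037690897, 1361106202724553683, 1358049298020148113, 1356876226230518963,
  1809038370145403783, 1349908763075344122, 1349348797305554010, 1345205800134090265, 1362362904694867722,
  1361184514121238572, 1352285241398384361, 1809095892787277912, 1360739236013628068, 2255837631092251501,
  2255837639490113109, 2253710125885126866, 1357881266961924833, 1357937240615644385, 2253227310137794232,
  2245703890153131519, 1356291278859584954, 1356291272227726131, 2252503395484317150, 1356705577673572884,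
  1349933737863562634, 2243859237171063255, 1818034242268877940, 2257997124145702558, 1374263100003827501,
  1374005559099564172, 1820275680030354429, 1827722680262497361, 1373224384203012037, 1373224404315538577,
  1828361652385863063, 1379271110079658670, 1380444181869287870, 1372303639216627588, 1372303631886678388,
  1383501079567418007, 1383501072237468803, 2255115544736994388, 1379772262161900800, 2242740767677204087,
  2241714942036673833, 2256852201493936870, 1378686158859584954, 1378686152227726131, 896079105305392068,
  456425711813208696, 448013544055419486, 904365305016485439, 448069531255854618, 456481699012769190,
  1384596906213754040, 1362202023063971019, 1361082278714886418, 9257462545101170, 2261249140148081492,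
  2261249148895819228, 2261246480755250450, 2261246489498001714, 1358926901653917947, 2258658192585254207,
  2247212589005485918, 2260836234598266581, 1351388193313369461, 1353733777057411022, 1362845883158280797,
  1792449482283037504, 1792478181823193148, 1799303161470928529, 1362845916400680865, 1797796965823193192,
  1799289164671147297, 1797768266283037635, 1351388193230263505, 1353733776974305090, 1358926887908185561,
  2260839042583794663, 2247940431354317162, 1355007710483581798, 1353735596646659786, 1352116026918618337,
  1800033794431147139, 1798113293503236910, 1798106009067037599, 2250819993333256476, 2240382166701805985,
  2256418720681561189, 1353716701001651814, 1344557754953610269, 1360606444496987685, 2260819454499594685,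
  1360606437831886475, 1370124339908670093, 1376128660556611078, 1373783076812569557, 1385240796216972803,
  1814844362283037504, 1821697971486928585, 1814872991839193244, 1385240762957951685, 1820191775839193122,
  1821683974687147235, 1820163146283037635, 1373783076729463435, 1376128660473505028, 1370124293003643679,
  1377402590299873844, 1374510910417818275, 1376130480145859860, 1822428604447147159, 1820500889067037599,
  1820508103519236956, 1377402596964975022, 1366952638452810325, 1376111584500851910, 1383001324313279745,
  454922819572918332, 904770992699772122, 448198763886570633, 453517547869949385, 454640084214011880,
  456042696525022332, 457218567674649393, 896263571097852158, 458335512227388045, 455759961166115880,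
  7893718708804534, 6771315666766107, 7054050587620881, 2251227447445232702, 1358925635981949293,
  1370123069001023431, 2256319623253407618, 1358926349537544783, 1370123789188477791, 1821119417706944427,
  1376619950347678104, 1374265968523767803, 1822185800656544275, 1383579393771384118, 1384757784345013374,
  1366483735494068507, 1383637993824894600, 1814400962436578327, 1375561780037712026, 1371690559790704056,
  1378092636623146934, 1385874863618478225, 1385821529162000516, 1384620764457007059, 469537641642087390,
  468378704869193676, 466145102487726884, 469551636692487191, 1380519987078617452, 1383636916437090072,
  465081352686041595, 1385876417698185459, 466314599154353610, 468599737627407601, 469666153819449210,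
  1379498482068021757, 2254860810115998819, 1355205640030470408, 1362225751479905622, 468962976800766396,
  466835617130530664, 470029532941566731, 469749598691667827, 1361106007828911422, 1362977652898579034,
  1360738151637483671, 1358125107078199715, 465718812456783255, 2254084127907678533]

theorem certificates_complete : filterThen single
    (search (fun rows => certificates.any fun n => certifies n rows) 5 [] zero) all [] = true := by
  decide +kernel

theorem xPart_vec_single (k : Fin 5) (r : Row) (n : Fin 10) :
    xPart (vec (Pi.single k 1) r) n = coord k r n := by
  refine Fin.addCases (m := 5) (n := 5) (fun i => ?_) (fun i => ?_) n
  · rw [xPart_vec_castAdd]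
    congr 1
    fin_cases k <;> fin_cases i <;> rfl
  · rw [xPart_vec_natAdd]
    congr 1
    fin_cases i <;> rfl

/-- The source of the coordinate `j` under the map encoded in `n`. -/
def source (n : ℕ) (j : Fin 10) : Fin 10 := ⟨digit n j % 10, Nat.mod_lt _ (by norm_num)⟩

theorem source_injective {n : ℕ} (h : isPerm n = true) : Function.Injective (source n) := by
  rw [Finite.injective_iff_surjective]
  intro i
  rw [isPerm, List.all_eq_true] at h
  have hi := h i (List.mem_range.2 i.2)
  rw [List.any_eq_true] at hi
  obtain ⟨j, hj, he⟩ := hi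
  rw [Nat.beq_eq] at he
  exact ⟨⟨j, List.mem_range.1 hj⟩, Fin.ext he⟩

theorem digit_div_lt (n j : ℕ) : digit n j / 10 < 2 := by
  have : digit n j < 20 := Nat.mod_lt _ (by norm_num)
  omega

theorem neg_one_pow_eq {n : ℕ} (h : n < 2) : (-1 : ZMod 3) ^ n = (n.succ : ℕ) := by
  interval_cases n <;> decide

theorem modEq_iff {m n : ℕ} : modEq m n = true ↔ (m : ZMod 3) = n := by
  rw [modEq, Nat.beq_eq, ZMod.natCast_eq_natCast_iff]
  rfl

theorem vec_eq_of_rowModEq {r x : Row} (h : rowModEq r x = true) (m : Fin 5 → ℕ) :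
    vec m r = vec m x := by
  simp only [rowModEq, Bool.and_eq_true, modEq_iff] at h
  obtain ⟨ha, hb, hc, hd, he, hs, ht⟩ := h
  rw [vec, ha, hb, hc, hd, he, hs, ht, vec]

theorem cols_imageRow (n k : ℕ) (r : Row) (i : Fin 5) :
    (imageRow n k r).cols i = imageCoord n k r (Fin.natAdd 5 i) := by
  fin_cases i <;> rfl

theorem exists_ySwap (n : ℕ) : ∃ τ : Equiv.Perm (Fin 2), ∀ (k : ℕ) (r : Row) (i : Fin 2),
    (imageRow n k r).ys i = (ySign n).succ * r.ys (τ i) := by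
  cases h : ySwap n with
  | true =>
    refine ⟨Equiv.swap 0 1, fun k r i => ?_⟩
    fin_cases i <;> simp [ys, imageRow, h]
  | false =>
    refine ⟨1, fun k r i => ?_⟩
    fin_cases i <;> simp [ys, imageRow, h]

theorem szEquiv_of_certifiesMap {n : ℕ} {R : Fin 5 → Row}
    (h : certifiesMap n (R 0) (R 1) (R 2) (R 3) (R 4) = true) :
    SZEquiv (code R) (szCode (targetIndex n)) := by
  simp only [certifiesMap, Bool.and_eq_true] at h
  obtain ⟨h4, h3, h2, h1, h0, hp⟩ := h
  have himage : ∀ k : Fin 5, imageOK n (target (targetIndex n)) k (R k) = true := by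
    intro k
    fin_cases k
    exacts [h0, h1, h2, h3, h4]
  obtain ⟨τ, hτ⟩ := exists_ySwap n
  let σ := Equiv.ofBijective _ (Finite.injective_iff_bijective.1 (source_injective hp))
  let α : Fin 10 → Fin 2 := fun j => ⟨digit n j / 10, digit_div_lt n j⟩
  let β : Fin 2 := ⟨ySign n, Nat.mod_lt _ (by norm_num)⟩
  rw [szCode_eq_code]
  refine code_szEquiv (finrank_code _) α β σ τ fun k => ?_
  have hmap : szMap α β σ τ (vec (Pi.single k 1) (R k)) =
      vec (fun i => imageCoord n k (R k) i) (imageRow n k (R k)) := by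
    have hx : ∀ j : Fin 10, xPart (szMap α β σ τ (vec (Pi.single k 1) (R k))) j =
        (imageCoord n k (R k) j : ℕ) := by
      intro j
      rw [xPart_szMap, xPart_vec_single, neg_one_pow_eq (α j).2, ← Nat.cast_mul]
      rfl
    apply ext_xPart_yPart
    · intro j
      rw [hx]
      refine Fin.addCases (m := 5) (n := 5) (fun i => ?_) (fun i => ?_) j
      · rw [xPart_vec_castAdd]
        rfl
      · rw [xPart_vec_natAdd, cols_imageRow]
    · intro j
      rw [yPart_szMap, yPart_vec, yPart_vec, hτ, neg_one_pow_eq β.2, Nat.cast_mul]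
  rw [hmap, vec_eq_of_rowModEq (himage k)]
  exact word_mem_code (target (targetIndex n)) fun i => imageCoord n k (R k) i

theorem exists_szEquiv_szCode {C : Submodule (ZMod 3) (Fin 12 → ZMod 3)} (hC : IsSZCode C) :
    ∃ i : Fin 7, SZEquiv C (szCode i) := by
  obtain ⟨R, hm, h⟩ := exists_isMinimal hC
  have hleaf := leaf_of_isMinimal certificates_complete (hC.of_szEquiv h) hm
  rw [List.any_eq_true] at hleaf
  obtain ⟨n, -, hn⟩ := hleaf
  rw [certifies, Bool.and_eq_true] at hn
  exact ⟨_, h.trans (szEquiv_of_certifiesMap hn.2)⟩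

end Row

theorem theorem1 :
    (∀ i : Fin 7, IsSZCode (szCode i)) ∧
    (∀ i j : Fin 7, SZEquiv (szCode i) (szCode j) → i = j) ∧
    (∀ C : Submodule (ZMod 3) (Fin 12 → ZMod 3), IsSZCode C →
      ∃ i : Fin 7, SZEquiv C (szCode i)) :=
  ⟨Row.isSZCode_szCode, fun _ _ => Row.eq_of_szEquiv_szCode, fun _ => Row.exists_szEquiv_szCode⟩
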